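/- Let $T$ be a complete first-order theory in a language $L$, and let $\mathbb{M} \models T$ be a monster model: $\mathbb{M}$ is $\kappa$-saturated for some cardinal $\kappa > |L| + \aleph_0$. Models $M \models T$ below are elementary substructures $M \preceq \mathbb{M}$ with $|M| < \kappa$; tuples of variables and parameters are finite; formulas $\varphi(x;y)$ are $L$-formulas; a set of formulas with parameters is consistent if it is finitely satisfiable. Definitions. * $\varphi(x;y)$ has SOP$_1$ if there are tuples $(a_\eta)_{\eta \in 2^{<\omega}}$ (in some model of $T$) such that $\{\varphi(x;a_{\eta|k}) : k < \omega\}$ is consistent for every $\eta \in 2^{\omega}$, and $\{\varphi(x;a_\nu), \varphi(x;a_{\eta \frown 1})\}$ is inconsistent whenever $\eta \in 2^{<\omega}$ and $\nu \unrhd \eta \frown 0$. $T$ is NSOP$_1$ if no formula has SOP$_1$. * A global type $q \in S_n(\mathbb{M})$ is $M$-invariant if $\theta(x;c) \in q \iff \theta(x;c') \in q$ for every $\theta$ and all $c, c'$ with $\operatorname{tp}(c/M) = \operatorname{tp}(c'/M)$. A Morley sequence in $q$ over $M$ is a sequence $(b_i)_{i<\omega}$ in $\mathbb{M}$ with $b_i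 \models q|_{M b_{<i}}$ for all $i$. If $q$ is $M$-invariant, $\varphi(x;y)$ $q$-divides over $M$ if $\{\varphi(x;b_i) : i < \omega\}$ is inconsistent for some (equivalently, any) Morley sequence $(b_i)_{i<\omega}$ in $q$ over $M$. * For an ultrafilter $\mathcal{D}$ on $M^n$ and $A \subseteq \mathbb{M}$, $\operatorname{Av}(\mathcal{D},A)$ is the set of formulas $\theta(y;a)$ with $a$ a tuple from $A$ and $\{b \in M^n : \mathbb{M} \models \theta(b;a)\} \in \mathcal{D}$. With $n$ the length of $y$, $(\varphi(x;y), M, \mathcal{D})$ is a higher formula if $\{\varphi(x;b_i) : i < \omega\}$ is consistent for every Morley sequence $(b_i)_{i<\omega}$ over $M$ in the global type $\operatorname{Av}(\mathcal{D},\mathbb{M})$. Theorem. The following are equivalent. 1. $T$ is NSOP$_1$. 2. (Ultrafilter independence of higher formulas) For every model $M \models T$, every formula $\varphi(x;y)$, and all ultrafilters $\mathcal{D}$, $\mathcal{E}$ on $M^{l(y)}$, where $l(y)$ is the length of $y$, with $\operatorname{Av}(\mathcal{D},M) = \operatorname{Av}(\mathcal{E},M)$: $(\varphi,M,\mathcal{D})$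 is a higher formula if and only if $(\varphi,M,\mathcal{E})$ is. 3. (Kim's lemma for Kim-dividing) For every model $M \models T$, every formula $\varphi(x;y)$ and every tuple $b$ in $\mathbb{M}$ of the length of $y$: if $\varphi(x;y)$ $q$-divides over $M$ for some global $M$-invariant type $q \supseteq \operatorname{tp}(b/M)$, then $\varphi(x;y)$ $q$-divides over $M$ for every global $M$-invariant type $q \supseteq \operatorname{tp}(b/M)$. -/

import Mathlib

open FirstOrder

universe u v w

namespace KimDividing



section Basic

variable {L : FirstOrder.Language.{u, v}} {N : Type w} [L.Structure N]

/-- The set of formulas `{φ(x; b i) : i ∈ ι}` is consistent: each of its finite subsets has a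
solution in the ambient structure `N`. -/
def Consistent {ι : Type*} {m n : ℕ} (φ : L.Formula (Fin m ⊕ Fin n)) (b : ι → Fin n → N) : Prop :=
  ∀ s : Finset ι, ∃ a : Fin m → N, ∀ i ∈ s, φ.Realize (Sum.elim a (b i))

/-- `φ(x; y)` has SOP₁ in `N`. Nodes of `2^{<ω}` are lists of Booleans (`false` is `0`, `true` is
`1`), extended by appending at the end; `<+:` is the tree order. -/
def FormulaSOP1 (N : Type w) [L.Structure N] {m n : ℕ} (φ : L.Formula (Fin m ⊕ Fin n)) : Prop :=
  ∃ a : List Bool → Fin n → N,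
    (∀ η : ℕ → Bool, Consistent φ (fun k : ℕ => a ((List.range k).map η))) ∧
    (∀ η ν : List Bool, (η ++ [false]) <+: ν → ¬ Consistent φ ![a ν, a (η ++ [true])])

/-- `T` has SOP₁: some formula has SOP₁ in some model of `T`. -/
def SOP1 (T : L.Theory) : Prop :=
  ∃ (N : FirstOrder.Language.Theory.ModelType.{u, v, max u v} T) (m n : ℕ)
    (φ : L.Formula (Fin m ⊕ Fin n)), FormulaSOP1 N φ

/-- `T` is NSOP₁. -/
def NSOP1 (T : L.Theory) : Prop := ¬ SOP1 T

/-- The formula with parameters `θ(x; a)`, as a formula in the language with constants for the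
elements of `N`. -/
noncomputable def inst {n k : ℕ} (θ : L.Formula (Fin n ⊕ Fin k)) (a : Fin k → N) :
    L[[N]].Formula (Fin n) :=
  FirstOrder.Language.BoundedFormula.constantsVarsEquiv.symm
    (θ.relabel (Sum.elim Sum.inr (Sum.inl ∘ a) : Fin n ⊕ Fin k → N ⊕ Fin n))

theorem realize_inst {n k : ℕ} (θ : L.Formula (Fin n ⊕ Fin k)) (a : Fin k → N) (v : Fin n → N) :
    (inst θ a).Realize v ↔ θ.Realize (Sum.elim v a) := by
  unfold inst FirstOrder.Language.Formula.Realize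
  rw [← FirstOrder.Language.BoundedFormula.realize_constantsVarsEquiv, Equiv.apply_symm_apply]
  refine (FirstOrder.Language.Formula.realize_relabel (φ := θ)).trans ?_
  unfold FirstOrder.Language.Formula.Realize
  rw [iff_iff_eq]
  congr 1
  funext x
  rcases x with i | j
  · simp
  · rfl

/-- The formulas `θ(x; a)`, `x` of length `n`, with parameters `a` from `A`. -/
def formulasOver (n : ℕ) (A : Set N) : Set (L[[N]].Formula (Fin n)) :=
  {ψ | ∃ (k : ℕ) (θ : L.Formula (Fin n ⊕ Fin k)) (a : Fin k → N), (∀ i, a i ∈ A) ∧ ψ = inst θ a}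

/-- The tuple `b` realizes the set of formulas `p`. -/
def Realizes {n : ℕ} (b : Fin n → N) (p : Set (L[[N]].Formula (Fin n))) : Prop :=
  ∀ ψ ∈ p, ψ.Realize b

variable (L) in
/-- The type `tp(b/A)`. -/
def tp {n : ℕ} (b : Fin n → N) (A : Set N) : Set (L[[N]].Formula (Fin n)) :=
  {ψ ∈ formulasOver n A | ψ.Realize b}

variable (L) in
/-- `N` is `κ`-saturated: every finitely satisfiable set of formulas, in finitely many variables,
over fewer than `κ` parameters is realized in `N`. -/
def IsSaturated (κ : Cardinal.{w}) (N : Type w) [L.Structure N] : Prop :=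
  ∀ (A : Set N), Cardinal.mk A < κ → ∀ (n : ℕ) (p : Set (L[[N]].Formula (Fin n))),
    p ⊆ formulasOver n A →
    (∀ s : Finset (L[[N]].Formula (Fin n)), (s : Set (L[[N]].Formula (Fin n))) ⊆ p →
      ∃ b : Fin n → N, Realizes b (s : Set (L[[N]].Formula (Fin n)))) →
    ∃ b : Fin n → N, Realizes b p

variable (L) in
/-- Global types in `n` variables: complete types over `N`, that is, complete types of the
elementary diagram of `N`. -/
abbrev GlobalType (N : Type w) [L.Structure N] (n : ℕ) :=
  (L.elementaryDiagram N).CompleteType (Fin n)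

/-- The set of formulas over `N` that belong to a global type. -/
def GlobalType.formulas {n : ℕ} (q : GlobalType L N n) : Set (L[[N]].Formula (Fin n)) :=
  {ψ | FirstOrder.Language.Formula.equivSentence ψ ∈ q}

/-- `q` is `A`-invariant: `c ≡_A c'` implies `θ(x; c) ∈ q ↔ θ(x; c') ∈ q`. -/
def GlobalType.IsInvariant {n : ℕ} (q : GlobalType L N n) (A : Set N) : Prop :=
  ∀ (k : ℕ) (θ : L.Formula (Fin n ⊕ Fin k)) (c c' : Fin k → N),
    tp L c A = tp L c' A → (inst θ c ∈ q.formulas ↔ inst θ c' ∈ q.formulas)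

/-- The average type `Av(D, A)` of an ultrafilter `D` on a set `I` of `n`-tuples. -/
def average {n : ℕ} {I : Set (Fin n → N)} (D : Ultrafilter I) (A : Set N) :
    Set (L[[N]].Formula (Fin n)) :=
  {ψ ∈ formulasOver n A | {b : I | ψ.Realize (b : Fin n → N)} ∈ D}

/-- The set `A^n` of `n`-tuples from `A`. -/
def tuples (n : ℕ) (A : Set N) : Set (Fin n → N) := {c | ∀ i, c i ∈ A}

/-- The set `A b_{<i}`: `A` together with the entries of the tuples `b j`, `j < i`. -/
def below {n : ℕ} (A : Set N) (b : ℕ → Fin n → N) (i : ℕ) : Set N :=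
  A ∪ {c | ∃ j < i, ∃ t : Fin n, c = b j t}

/-- `(b i)_{i < ω}` is a Morley sequence over `A` in the global type with set of formulas `q`:
each `b i` realizes the restriction of `q` to `A b_{<i}`. -/
def IsMorleySequence {n : ℕ} (q : Set (L[[N]].Formula (Fin n))) (A : Set N)
    (b : ℕ → Fin n → N) : Prop :=
  ∀ i, Realizes (b i) (q ∩ formulasOver n (below A b i))

/-- `φ(x; y)` `q`-divides over `A`. -/
def QDivides {m n : ℕ} (φ : L.Formula (Fin m ⊕ Fin n)) (q : GlobalType L N n) (A : Set N) : Prop :=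
  ∃ b : ℕ → Fin n → N, IsMorleySequence q.formulas A b ∧ ¬ Consistent φ b

/-- `(φ, A, D)` is a higher formula: with `q = Av(D, N)`, the instances of `φ` along Morley
sequences in `q` over `A` are consistent. -/
def IsHigher {m n : ℕ} (φ : L.Formula (Fin m ⊕ Fin n)) (A : Set N)
    (D : Ultrafilter (tuples n A)) : Prop :=
  ∀ b : ℕ → Fin n → N, IsMorleySequence (average (L := L) D Set.univ) A b → Consistent φ b

end Basic

end KimDividing

-- Passing from Kim's lemma to ultrafilter independence is formal: the average of an ultrafilter on
-- tuples from a model is invariant over that model, and a formula is higher exactly when it does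
-- not divide along the average. The other two implications are constructions of trees and arrays.
--
-- Kim's lemma from NSOP₁ (`sop1_of_qDivides`): suppose `φ` divides along `q` but not along `r`,
-- both extending `tp(b/M)`. Consider sequences of realizations of `r` followed by realizations of
-- `q`, each over `M` and its predecessors. Let `l + 1` be least such that, after some number `k` of
-- `r`'s, `l + 1` many `q`'s make `φ` inconsistent. A tree of blocks of `k + 1` tuples is grown from
-- the leaves down (`exists_isBlockTree_succ`). Its paths, read from leaf to root, are Morley
-- sequences in `r`, and the first tuple of a right child realizes `q` over every single block above
-- its left sibling. Add `l` realizations of `q` over the whole tree to every block. A path then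
-- carries `r`'s followed by `l` many `q`'s, which is consistent; the two nodes at a split contain
-- `k + 1` many `r`'s followed by `l + 1` many `q`'s, which is not. By compactness, a conjunction of
-- instances of `φ` has SOP₁.
--
-- NSOP₁ from ultrafilter independence (`SOP1.exists_ultrafilters`): in an SOP₁ tree, the pigeonhole
-- principle gives two columns, one along a path and one of pairwise inconsistent turn-offs, with
-- rows alike over the previous rows (`exists_array`). An ultraproduct makes them alike over the
-- Skolem hull of the array (`exists_isSkolemArray`), which embeds in the monster as a small model.
-- Nonprincipal ultrafilters on the two columns have the same average over this model, but only the
-- path column makes `φ` higher (`IsSkolemArray.exists_ultrafilters`).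

universe z

namespace KimDividing

open FirstOrder.Language

/-! ### Equality of types across structures -/

section SameType

variable {L : FirstOrder.Language.{u, v}}

/-- The tuples `x` and `y`, possibly in different structures, satisfy the same formulas. -/
def SameType (L : FirstOrder.Language.{u, v}) {ι P Q : Type*} [L.Structure P] [L.Structure Q]
    (x : ι → P) (y : ι → Q) : Prop :=
  ∀ θ : L.Formula ι, θ.Realize x ↔ θ.Realize y

variable {ι ι' P Q R : Type*} [L.Structure P] [L.Structure Q] [L.Structure R]

theorem SameType.refl (x : ι → P) : SameType L x x := fun _ => Iff.rfl

theorem SameType.symm {x : ι → P} {y : ι → Q} (h : SameType L x y) : SameType L y x :=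
  fun θ => (h θ).symm

theorem SameType.trans {x : ι → P} {y : ι → Q} {z : ι → R} (h : SameType L x y)
    (h' : SameType L y z) : SameType L x z :=
  fun θ => (h θ).trans (h' θ)

theorem SameType.comp {x : ι → P} {y : ι → Q} (h : SameType L x y) (f : ι' → ι) :
    SameType L (x ∘ f) (y ∘ f) := fun θ => by
  simpa only [Formula.realize_relabel] using h (θ.relabel f)

theorem SameType.reindex {x : ι → P} {y : ι → Q} (h : SameType L x y) (f : ι' → ι) {x' : ι' → P}
    {y' : ι' → Q} (hx : ∀ i, x (f i) = x' i) (hy : ∀ i, y (f i) = y' i) : SameType L x' y' := by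
  have := h.comp f
  rwa [show x ∘ f = x' from funext hx, show y ∘ f = y' from funext hy] at this

theorem SameType.of_imp {x : ι → P} {y : ι → Q}
    (h : ∀ θ : L.Formula ι, θ.Realize x → θ.Realize y) : SameType L x y := fun θ =>
  ⟨h θ, fun hy => by
    by_contra hx
    exact (Formula.realize_not.1 (h θ.not (Formula.realize_not.2 hx))) hy⟩

theorem SameType.eq_of_eq {x : ι → P} {y : ι → Q} (h : SameType L x y) {i j : ι}
    (hij : x i = x j) : y i = y j := by
  have := h ((Term.var i).equal (Term.var j))
  simpa [Formula.realize_equal, hij] using this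

/-- The number of right variables of a formula. -/
noncomputable def rightCard {β ι : Type*} (θ : L.Formula (β ⊕ ι)) : ℕ := by
  classical exact (θ.freeVarFinset.toRight).card

/-- An enumeration of the right variables of a formula. -/
noncomputable def rightVars {β ι : Type*} (θ : L.Formula (β ⊕ ι)) : Fin (rightCard θ) → ι := by
  classical exact fun i => (θ.freeVarFinset.toRight).equivFin.symm i

/-- The formula `θ`, with its right variables renamed to an initial segment of the numbers. -/
noncomputable def restrictRight {β ι : Type*} (θ : L.Formula (β ⊕ ι)) :
    L.Formula (β ⊕ Fin (rightCard θ)) := by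
  classical exact θ.restrictFreeVar fun a => match a with
    | ⟨Sum.inl b, _⟩ => Sum.inl b
    | ⟨Sum.inr i, h⟩ => Sum.inr ((θ.freeVarFinset.toRight).equivFin ⟨i, by simpa using h⟩)

theorem realize_restrictRight {β ι : Type*} (θ : L.Formula (β ⊕ ι)) (b : β → P) (x : ι → P) :
    (restrictRight θ).Realize (Sum.elim b (x ∘ rightVars θ)) ↔ θ.Realize (Sum.elim b x) := by
  classical
  refine BoundedFormula.realize_restrictFreeVar _ ?_
  rintro ⟨a | i, h⟩
  · rfl
  · change x ((θ.freeVarFinset.toRight).equivFin.symm ((θ.freeVarFinset.toRight).equivFin _)) = x i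
    rw [Equiv.symm_apply_apply]

/-- A formula has finitely many free variables. This reduces types over arbitrary families to
formulas with `Fin k` parameters, the form in which `inst` and saturation are stated. -/
theorem SameType.of_forall_fin {β : Type*} {b : β → P} {c : β → Q} {x : ι → P} {y : ι → Q}
    (h : ∀ (k : ℕ) (s : Fin k → ι), SameType L (Sum.elim b (x ∘ s)) (Sum.elim c (y ∘ s))) :
    SameType L (Sum.elim b x) (Sum.elim c y) := fun θ => by
  rw [← realize_restrictRight θ b x, ← realize_restrictRight θ c y]
  exact h _ _ _

/-- The formula `∃ x, ⋀ i ∈ F, φ(x; s i)`. -/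
noncomputable def exConj {β γ ι τ : Type*} [Finite β] (φ : L.Formula (β ⊕ γ)) (F : Finset τ)
    (s : τ → γ → ι) : L.Formula ι :=
  Formula.iExs β (Formula.iInf fun i : F => φ.relabel (Sum.elim Sum.inr (Sum.inl ∘ s i)))

theorem realize_exConj {β γ ι τ : Type*} [Finite β] (φ : L.Formula (β ⊕ γ)) (F : Finset τ)
    (s : τ → γ → ι) (x : ι → P) :
    (exConj φ F s).Realize x ↔
      ∃ a : β → P, ∀ i ∈ F, φ.Realize (Sum.elim a (x ∘ s i)) := by
  unfold exConj
  rw [Formula.realize_iExs]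
  refine exists_congr fun a => ?_
  rw [Formula.realize_iInf]
  simp only [Formula.realize_relabel, Subtype.forall]
  refine forall₂_congr fun i _ => ?_
  rw [iff_iff_eq]
  congr 1
  funext z
  rcases z with z | z <;> rfl

theorem SameType.exists_forall_iff {β γ τ : Type*} [Finite β] {x : ι → P} {y : ι → Q}
    (h : SameType L x y) (φ : L.Formula (β ⊕ γ)) (F : Finset τ) (s : τ → γ → ι) :
    (∃ a : β → P, ∀ i ∈ F, φ.Realize (Sum.elim a (x ∘ s i))) ↔
      ∃ a : β → Q, ∀ i ∈ F, φ.Realize (Sum.elim a (y ∘ s i)) := by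
  rw [← realize_exConj, ← realize_exConj]
  exact h _

end SameType

/-! ### Saturation for small families -/

section Saturation

variable {L : FirstOrder.Language.{u, v}} {N : Type w} [L.Structure N] {κ : Cardinal.{w}}

/-- A small type of a finite tuple, in any structure, transfers to a saturated structure. -/
theorem IsSaturated.exists_tuple (h : IsSaturated L κ N) {ι P : Type*} [L.Structure P]
    {x : ι → P} {y : ι → N} (hxy : SameType L x y) (hy : Cardinal.mk (Set.range y) < κ) {n : ℕ}
    (a : Fin n → P) : ∃ b : Fin n → N, SameType L (Sum.elim a x) (Sum.elim b y) := by
  classical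
  let p : Set (L[[N]].Formula (Fin n)) := {ψ | ∃ (k : ℕ) (θ : L.Formula (Fin n ⊕ Fin k))
    (s : Fin k → ι), θ.Realize (Sum.elim a (x ∘ s)) ∧ ψ = inst θ (y ∘ s)}
  obtain ⟨b, hb⟩ := h (Set.range y) hy n p
    (by rintro ψ ⟨k, θ, s, -, rfl⟩; exact ⟨k, θ, y ∘ s, fun i => ⟨s i, rfl⟩, rfl⟩) (by
      intro F hF
      have hF' : ∀ ψ : F, ψ.1 ∈ p := fun ψ => hF ψ.2
      choose k θ s hθ hψ using hF'
      let Θ : L.Formula ι := Formula.iExs (Fin n) (Formula.iInf fun ψ : F =>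
        (θ ψ).relabel (Sum.elim Sum.inr (Sum.inl ∘ s ψ)))
      have h1 : Θ.Realize x := by
        rw [Formula.realize_iExs]
        refine ⟨a, ?_⟩
        rw [Formula.realize_iInf]
        intro ψ
        rw [Formula.realize_relabel]
        convert hθ ψ using 1
        funext z; rcases z with z | z <;> rfl
      rw [hxy, Formula.realize_iExs] at h1
      obtain ⟨b, hb⟩ := h1
      rw [Formula.realize_iInf] at hb
      refine ⟨b, fun ψ hψF => ?_⟩
      have := hb ⟨ψ, hψF⟩
      rw [Formula.realize_relabel] at this
      have e := hψ ⟨ψ, hψF⟩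
      simp only at e
      rw [e, realize_inst]
      convert this using 1
      funext z; rcases z with z | z <;> rfl)
  refine ⟨b, SameType.of_forall_fin fun k s => SameType.of_imp fun θ hθ => ?_⟩
  exact (realize_inst _ _ _).1 (hb _ ⟨k, θ, s, hθ, rfl⟩)

/-- A small type of a small tuple, in any structure, transfers to a saturated structure. -/
theorem IsSaturated.exists_family (h : IsSaturated L κ N) (hκ : Cardinal.aleph0 < κ)
    [Nonempty N] {ι : Type*} {τ : Type z} {P : Type*} [L.Structure P]
    {x : ι → P} {y : ι → N} (hxy : SameType L x y) (hy : Cardinal.mk (Set.range y) < κ)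
    (a : τ → P) (hτ : Cardinal.lift.{w} (Cardinal.mk τ) < Cardinal.lift.{z} κ) :
    ∃ b : τ → N, SameType L (Sum.elim x a) (Sum.elim y b) := by
  classical
  -- Zorn's lemma is applied to relations instead of partial functions. Since equality is a formula,
  -- every member of `S` is functional anyway.
  let S : Set (Set (τ × N)) := {G | SameType L (Sum.elim x fun g : G => a g.1.1)
    (Sum.elim y fun g : G => g.1.2)}
  have h0 : (∅ : Set (τ × N)) ∈ S := by
    refine hxy.reindex (Sum.elim id (fun g : (∅ : Set (τ × N)) => g.2.elim)) ?_ ?_ <;>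
    · rintro (i | g)
      · rfl
      · exact g.2.elim
  obtain ⟨G, -, hG⟩ := zorn_subset_nonempty S (fun c hcS hc hne => by
    refine ⟨⋃₀ c, SameType.of_forall_fin fun k s => ?_, fun _ => Set.subset_sUnion_of_mem⟩
    obtain ⟨G, hGc, hG⟩ := DirectedOn.exists_mem_subset_of_finset_subset_biUnion (f := id) hne
      hc.directedOn (s := Finset.univ.image fun i => (s i).1) (by
        intro g hg
        simp only [Finset.coe_image, Finset.coe_univ, Set.image_univ, Set.mem_range] at hg
        obtain ⟨i, rfl⟩ := hg
        simpa only [Set.sUnion_eq_biUnion, id_eq] using (s i).2)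
    have hG' : ∀ i, (s i).1 ∈ G := fun i => hG (by simp)
    refine SameType.reindex (hcS hGc) (Sum.map id fun i : Fin k => (⟨(s i).1, hG' i⟩ : G)) ?_ ?_ <;>
    · rintro (i | i) <;> rfl) ∅ h0
  have hGS : SameType L (Sum.elim x fun g : G => a g.1.1) (Sum.elim y fun g : G => g.1.2) := hG.prop
  have hfun : ∀ i c c', (i, c) ∈ G → (i, c') ∈ G → c = c' := fun i c c' hc hc' =>
    hGS.eq_of_eq (i := Sum.inr ⟨_, hc⟩) (j := Sum.inr ⟨_, hc'⟩) rfl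
  have hcard : Cardinal.mk (Set.range (Sum.elim y fun g : G => g.1.2)) < κ := by
    let f : τ → N := fun i => if hi : ∃ c, (i, c) ∈ G then hi.choose else Classical.arbitrary N
    have hsub : Set.range (Sum.elim y fun g : G => g.1.2) ⊆ Set.range y ∪ Set.range f := by
      rintro _ ⟨i | g, rfl⟩
      · exact Or.inl ⟨i, rfl⟩
      · have hg : ∃ c, (g.1.1, c) ∈ G := ⟨g.1.2, g.2⟩
        refine Or.inr ⟨g.1.1, ?_⟩
        simp only [f, dif_pos hg, Sum.elim_inr]
        exact hfun _ _ _ hg.choose_spec g.2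
    refine (Cardinal.mk_le_mk_of_subset hsub).trans_lt ((Cardinal.mk_union_le _ _).trans_lt ?_)
    refine Cardinal.add_lt_of_lt hκ.le hy ?_
    rw [← Cardinal.lift_lt.{w, z}]
    exact Cardinal.mk_range_le_lift.trans_lt hτ
  have htot : ∀ i, ∃ c, (i, c) ∈ G := by
    intro i
    obtain ⟨b, hb⟩ := h.exists_tuple hGS hcard (fun _ : Fin 1 => a i)
    have hins : insert (i, b 0) G ∈ S := by
      have hmem : ∀ g : ↥(insert (i, b 0) G), g.1 ≠ (i, b 0) → g.1 ∈ G := fun g hg =>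
        g.2.resolve_left hg
      refine hb.reindex (Sum.elim (Sum.inr ∘ Sum.inl) fun g : ↥(insert (i, b 0) G) =>
        if hg : g.1 = (i, b 0) then Sum.inl 0 else Sum.inr (Sum.inr ⟨g.1, hmem g hg⟩)) ?_ ?_ <;>
      · rintro (z | z)
        · rfl
        · by_cases hg : z.1 = (i, b 0) <;> simp [hg]
    exact ⟨b 0, hG.le_of_ge hins (Set.subset_insert _ _) (Set.mem_insert _ _)⟩
  choose b hb using htot
  refine ⟨b, hGS.reindex (Sum.map id fun i => (⟨(i, b i), hb i⟩ : G)) ?_ ?_⟩ <;>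
  · rintro (i | i) <;> rfl

end Saturation

/-! ### Invariant types and their realizations -/

section Generic

variable {L : FirstOrder.Language.{u, v}} {n : ℕ}

theorem formulasOver_mono {N : Type w} {A B : Set N} (h : A ⊆ B) :
    formulasOver (L := L) n A ⊆ formulasOver n B := by
  rintro _ ⟨k, θ, a, ha, rfl⟩
  exact ⟨k, θ, a, fun i => h (ha i), rfl⟩

theorem realize_inst_of_isExpansionOn {N P : Type*} [L.Structure P] [L[[N]].Structure P]
    [(L.lhomWithConstants N).IsExpansionOn P] {k : ℕ} (θ : L.Formula (Fin n ⊕ Fin k))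
    (a : Fin k → N) (e : Fin n → P) :
    (inst θ a).Realize e ↔ θ.Realize (Sum.elim e fun i => (L.con (a i) : P)) := by
  unfold inst Formula.Realize
  rw [← BoundedFormula.realize_constantsVarsEquiv, Equiv.apply_symm_apply]
  refine (Formula.realize_relabel (φ := θ)).trans ?_
  unfold Formula.Realize
  rw [iff_iff_eq]
  congr 1
  funext x
  rcases x with i | i <;> rfl

variable {N : Type w} [L.Structure N]

theorem tp_eq_iff_sameType {k : ℕ} {A : Set N} {c c' : Fin k → N} :
    tp L c A = tp L c' A ↔
      SameType L (Sum.elim c ((↑) : A → N)) (Sum.elim c' ((↑) : A → N)) := by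
  constructor
  · intro h
    refine SameType.of_forall_fin fun l s => SameType.of_imp fun θ hθ => ?_
    have : inst θ ((↑) ∘ s) ∈ tp L c A :=
      ⟨⟨l, θ, _, fun i => (s i).2, rfl⟩, (realize_inst _ _ _).2 hθ⟩
    rw [h] at this
    exact (realize_inst _ _ _).1 this.2
  · intro h
    ext ψ
    refine and_congr_right ?_
    rintro ⟨l, θ, a, ha, rfl⟩
    rw [realize_inst, realize_inst]
    refine h.reindex (Sum.map id fun i => (⟨a i, ha i⟩ : A)) ?_ ?_ θ <;>
    · rintro (i | i) <;> rfl

/-- The tuple `c` realizes the restriction of `q` to `A`. -/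
def GlobalType.Generic (q : GlobalType L N n) (A : Set N) (c : Fin n → N) : Prop :=
  Realizes c (q.formulas ∩ formulasOver n A)

theorem GlobalType.Generic.mono {q : GlobalType L N n} {A B : Set N} {c : Fin n → N}
    (h : q.Generic B c) (hAB : A ⊆ B) : q.Generic A c :=
  fun ψ hψ => h ψ ⟨hψ.1, formulasOver_mono hAB hψ.2⟩

/-- `P` is an elementary extension of `N`, along `j`, where `d` realizes `q`. -/
structure IsRealization (q : GlobalType L N n) {P : Type*} [L.Structure P] (j : N → P)
    (d : Fin n → P) : Prop where
  sameType : SameType L id j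
  mem_iff : ∀ (k : ℕ) (θ : L.Formula (Fin n ⊕ Fin k)) (a : Fin k → N),
    inst θ a ∈ q.formulas ↔ θ.Realize (Sum.elim d (j ∘ a))

variable {q : GlobalType L N n} {P : Type*} [L.Structure P] {j : N → P} {d : Fin n → P}

theorem IsRealization.sameType_of_generic (hq : IsRealization q j d) {A : Set N} {c : Fin n → N}
    (hc : q.Generic A c) {ι : Type*} (y : ι → N) (hy : ∀ i, y i ∈ A) :
    SameType L (Sum.elim d (j ∘ y)) (Sum.elim c y) := by
  refine SameType.of_forall_fin fun k s => SameType.of_imp fun θ hθ => ?_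
  exact (realize_inst _ _ _).1 (hc _ ⟨(hq.mem_iff k θ (y ∘ s)).2 hθ,
    k, θ, y ∘ s, fun i => hy _, rfl⟩)

theorem IsRealization.generic_of_sameType (hq : IsRealization q j d) {A : Set N} {c : Fin n → N}
    {ι : Type*} (y : ι → N) (hy : ∀ a ∈ A, ∃ i, y i = a)
    (h : SameType L (Sum.elim d (j ∘ y)) (Sum.elim c y)) : q.Generic A c := by
  rintro _ ⟨hψ, k, θ, a, ha, rfl⟩
  choose s hs using fun i => hy (a i) (ha i)
  rw [hq.mem_iff] at hψ
  rw [realize_inst]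
  refine (h.reindex (Sum.map id s) ?_ ?_ θ).1 hψ
  · rintro (i | i)
    · rfl
    · simp [hs]
  · rintro (i | i)
    · rfl
    · simp [hs]

/-- With a realization `d` of `q` outside `N`, membership in `q` becomes truth at `d`, and
invariance becomes equality of types over `d`. -/
theorem IsRealization.sameType_of_isInvariant (hq : IsRealization q j d) {A : Set N}
    (hinv : q.IsInvariant A) {ι : Type*} {x y : ι → N}
    (hxy : SameType L (Sum.elim ((↑) : A → N) x) (Sum.elim ((↑) : A → N) y)) :
    SameType L (Sum.elim d (j ∘ Sum.elim ((↑) : A → N) x))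
      (Sum.elim d (j ∘ Sum.elim ((↑) : A → N) y)) := by
  refine SameType.of_forall_fin fun k s => SameType.of_imp fun θ hθ => ?_
  refine (hq.mem_iff k θ (Sum.elim ((↑) : A → N) y ∘ s)).1
    ((hinv k θ (Sum.elim ((↑) : A → N) x ∘ s) _ ?_).1 ((hq.mem_iff k θ _).2 hθ))
  rw [tp_eq_iff_sameType]
  refine hxy.reindex (Sum.elim s Sum.inl) ?_ ?_ <;>
  · rintro (i | i) <;> rfl

/-- A global type is the type of a tuple in an elementary extension. -/
theorem GlobalType.exists_isRealization (q : GlobalType L N n) :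
    ∃ (P : Type (max u v w)) (_ : L.Structure P) (j : N → P) (d : Fin n → P),
      IsRealization q j d := by
  obtain ⟨P, d, hd⟩ := Theory.exists_modelType_is_realized_in _ q
  let _ : L.Structure P := (L.lhomWithConstants N).reduct P
  have _ : (L.lhomWithConstants N).IsExpansionOn P := LHom.isExpansionOn_reduct _ _
  refine ⟨P, inferInstance, ElementaryEmbedding.ofModelsElementaryDiagram L N P, d, ?_, ?_⟩
  · exact fun θ => ((ElementaryEmbedding.ofModelsElementaryDiagram L N P).map_formula θ id).symm
  · intro k θ a
    subst hd
    exact (Theory.CompleteType.formula_mem_typeOf (T := L.elementaryDiagram N) (v := d)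
      (φ := inst θ a)).trans (realize_inst_of_isExpansionOn θ a d)

theorem GlobalType.exists_generic {κ : Cardinal.{w}} (hN : IsSaturated L κ N)
    (q : GlobalType L N n) {A : Set N} (hA : Cardinal.mk A < κ) : ∃ c, q.Generic A c := by
  obtain ⟨P, _, j, d, hq⟩ := q.exists_isRealization
  have h : SameType L (j ∘ ((↑) : A → N)) ((↑) : A → N) := hq.sameType.symm.comp _
  obtain ⟨c, hc⟩ := hN.exists_tuple h (by simpa using hA) d
  exact ⟨c, hq.generic_of_sameType ((↑) : A → N) (fun a ha => ⟨⟨a, ha⟩, rfl⟩) hc⟩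

/-- Realizations of an invariant type over tuples of the same type have the same type. -/
theorem GlobalType.Generic.sameType {q : GlobalType L N n} {A B B' : Set N}
    (hinv : q.IsInvariant A) {ι : Type*} {x y : ι → N} {c c' : Fin n → N} (hc : q.Generic B c)
    (hc' : q.Generic B' c') (hAB : A ⊆ B) (hx : ∀ i, x i ∈ B) (hAB' : A ⊆ B') (hy : ∀ i, y i ∈ B')
    (hxy : SameType L (Sum.elim ((↑) : A → N) x) (Sum.elim ((↑) : A → N) y)) :
    SameType L (Sum.elim c (Sum.elim ((↑) : A → N) x)) (Sum.elim c' (Sum.elim ((↑) : A → N) y)) := by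
  obtain ⟨P, _, j, d, hq⟩ := q.exists_isRealization
  refine (hq.sameType_of_generic hc _ ?_).symm.trans
    ((hq.sameType_of_isInvariant hinv hxy).trans (hq.sameType_of_generic hc' _ ?_))
  · rintro (a | i)
    exacts [hAB a.2, hx i]
  · rintro (a | i)
    exacts [hAB' a.2, hy i]

/-- Being a realization of an invariant type depends only on the type over the base. -/
theorem GlobalType.Generic.transfer {q : GlobalType L N n} {A : Set N}
    (hinv : q.IsInvariant A) {ι : Type*} {x y : ι → N}
    (hxy : SameType L (Sum.elim ((↑) : A → N) x) (Sum.elim ((↑) : A → N) y)) {s : Fin n → ι}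
    {S : Set ι} (h : q.Generic (A ∪ x '' S) (x ∘ s)) : q.Generic (A ∪ y '' S) (y ∘ s) := by
  obtain ⟨P, _, j, d, hq⟩ := q.exists_isRealization
  refine hq.generic_of_sameType (Sum.elim ((↑) : A → N) fun i : S => y i) ?_ ?_
  · rintro _ (ha | ⟨i, hi, rfl⟩)
    · exact ⟨Sum.inl ⟨_, ha⟩, rfl⟩
    · exact ⟨Sum.inr ⟨i, hi⟩, rfl⟩
  · have h1 := hq.sameType_of_generic h (Sum.elim ((↑) : A → N) fun i : S => x i) (by
      rintro (a | i)
      exacts [Or.inl a.2, Or.inr ⟨i, i.2, rfl⟩])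
    have h2 := hq.sameType_of_isInvariant hinv (x := fun i : S => x i) (y := fun i : S => y i)
      (hxy.reindex (Sum.map id (↑)) (by rintro (i | i) <;> rfl) (by rintro (i | i) <;> rfl))
    refine h2.symm.trans (h1.trans ?_)
    refine hxy.reindex (Sum.elim (Sum.inr ∘ s) (Sum.map id (↑))) ?_ ?_ <;>
    · rintro (i | i | i) <;> rfl

end Generic

/-! ### Finite Morley sequences in varying types -/

section MorleyList

variable {L : FirstOrder.Language.{u, v}} {N : Type w} [L.Structure N] {n : ℕ}

/-- The set of entries of the tuples in a list. -/
def entries (l : List (Fin n → N)) : Set N := {a | ∃ c ∈ l, ∃ t, a = c t}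

/-- Each tuple of the second list realizes the corresponding type of the first list over `A` and
the tuples further down the list. -/
inductive MorleyList (A : Set N) : List (GlobalType L N n) → List (Fin n → N) → Prop
  | nil : MorleyList A [] []
  | cons {p : GlobalType L N n} {ps : List (GlobalType L N n)} {c : Fin n → N}
      {l : List (Fin n → N)} (h : MorleyList A ps l) (hc : p.Generic (A ∪ entries l) c) :
      MorleyList A (p :: ps) (c :: l)

theorem entries_cons (c : Fin n → N) (l : List (Fin n → N)) :
    entries (c :: l) = Set.range c ∪ entries l := by
  ext a
  simp [entries, eq_comm]

theorem entries_append (l l' : List (Fin n → N)) :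
    entries (l ++ l') = entries l ∪ entries l' := by
  ext a
  simp [entries, or_and_right, exists_or]

theorem entries_map {ι : Type*} (x : ι → N) (s : List (Fin n → ι)) :
    entries (s.map (x ∘ ·)) = x '' {i | ∃ f ∈ s, ∃ t, i = f t} := by
  ext a
  simp only [entries, List.mem_map, Set.mem_image]
  constructor
  · rintro ⟨_, ⟨f, hf, rfl⟩, t, rfl⟩
    exact ⟨f t, ⟨f, hf, t, rfl⟩, rfl⟩
  · rintro ⟨_, ⟨f, hf, t, rfl⟩, rfl⟩
    exact ⟨_, ⟨f, hf, rfl⟩, t, rfl⟩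

theorem finite_entries (l : List (Fin n → N)) : (entries l).Finite := by
  induction l with
  | nil => simp [entries]
  | cons c l ih => rw [entries_cons]; exact (Set.finite_range c).union ih

theorem MorleyList.length_eq {A : Set N} {ps : List (GlobalType L N n)} {l : List (Fin n → N)}
    (h : MorleyList A ps l) : l.length = ps.length := by
  induction h with
  | nil => rfl
  | cons _ _ ih => simp [ih]

theorem MorleyList.mono {A B : Set N} (hAB : A ⊆ B) {ps : List (GlobalType L N n)}
    {l : List (Fin n → N)} (h : MorleyList B ps l) : MorleyList A ps l := by
  induction h with
  | nil => exact .nil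
  | cons _ hc ih => exact .cons ih (hc.mono (Set.union_subset_union_left _ hAB))

/-- The head of a list is realized last, so the tuples chosen later stand on the left. -/
theorem MorleyList.append {A : Set N} {ps qs : List (GlobalType L N n)} {l l' : List (Fin n → N)}
    (h : MorleyList A ps l) (h' : MorleyList (A ∪ entries l) qs l') :
    MorleyList A (qs ++ ps) (l' ++ l) := by
  induction h' with
  | nil => exact h
  | cons _ hc ih =>
    rw [List.cons_append, List.cons_append]
    refine .cons ih (hc.mono ?_)
    rw [entries_append, Set.union_assoc, Set.union_comm (entries l)]

theorem MorleyList.exists_of_isSaturated {κ : Cardinal.{w}} (hκ : Cardinal.aleph0 < κ)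
    (hN : IsSaturated L κ N) {A : Set N} (hA : Cardinal.mk A < κ)
    (ps : List (GlobalType L N n)) : ∃ l, MorleyList A ps l := by
  induction ps with
  | nil => exact ⟨[], .nil⟩
  | cons p ps ih =>
    obtain ⟨l, hl⟩ := ih
    obtain ⟨c, hc⟩ := p.exists_generic hN (A := A ∪ entries l)
      ((Cardinal.mk_union_le _ _).trans_lt (Cardinal.add_lt_of_lt hκ.le hA
        ((finite_entries l).lt_aleph0.trans hκ)))
    exact ⟨c :: l, .cons hl hc⟩

/-- By invariance, the type of each new tuple over `A` and the earlier ones is determined by the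
type of the earlier ones. Both lists are images of one list of indices, so that the resulting
equality of types can be reindexed. -/
theorem MorleyList.exists_sameType {A : Set N} {ps : List (GlobalType L N n)}
    (hps : ∀ p ∈ ps, p.IsInvariant A) {l l' : List (Fin n → N)} (h : MorleyList A ps l)
    (h' : MorleyList A ps l') : ∃ (ι : Type) (x y : ι → N) (s : List (Fin n → ι)),
      l = s.map (x ∘ ·) ∧ l' = s.map (y ∘ ·) ∧
      SameType L (Sum.elim ((↑) : A → N) x) (Sum.elim ((↑) : A → N) y) := by
  induction h generalizing l' with
  | nil =>
    cases h'
    refine ⟨Empty, Empty.elim, Empty.elim, [], rfl, rfl, ?_⟩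
    exact (Subsingleton.elim _ _ : (Empty.elim : Empty → N) = Empty.elim) ▸ SameType.refl _
  | @cons p ps c l h hc ih =>
    cases h' with
    | @cons _ _ c' l' h' hc' =>
    obtain ⟨ι, x, y, s, rfl, rfl, hxy⟩ := ih (fun p hp => hps p (List.mem_cons_of_mem _ hp)) h'
    -- The new tuple is generic only over the entries that occur in the list, so the other indices
    -- are dropped.
    let S : Set ι := {i | ∃ f ∈ s, ∃ t, i = f t}
    rw [entries_map] at hc hc'
    have := hc.sameType (hps p List.mem_cons_self) hc' (x := fun i : S => x i)
      (y := fun i : S => y i) Set.subset_union_left (fun i => Or.inr ⟨i, i.2, rfl⟩)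
      Set.subset_union_left (fun i => Or.inr ⟨i, i.2, rfl⟩)
      (hxy.reindex (Sum.map id (↑)) (by rintro (i | i) <;> rfl) (by rintro (i | i) <;> rfl))
    refine ⟨Fin n ⊕ S, Sum.elim c fun i => x i, Sum.elim c' fun i => y i,
      Sum.inl :: s.attach.map fun f t => Sum.inr ⟨f.1 t, f.1, f.2, t, rfl⟩, ?_, ?_, ?_⟩
    · simp only [List.map_cons, List.map_map]
      congr 1
      conv_lhs => rw [← List.attach_map_subtype_val s, List.map_map]
      rfl
    · simp only [List.map_cons, List.map_map]
      congr 1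
      conv_lhs => rw [← List.attach_map_subtype_val s, List.map_map]
      rfl
    · refine this.reindex (Sum.elim (Sum.inr ∘ Sum.inl) (Sum.map id Sum.inr)) ?_ ?_ <;>
      · rintro (i | i | i) <;> rfl

/-- Whether a formula is consistent along a Morley list depends only on the types in the list. -/
theorem MorleyList.consistent_iff {A : Set N} {ps : List (GlobalType L N n)}
    (hps : ∀ p ∈ ps, p.IsInvariant A) {l l' : List (Fin n → N)} (h : MorleyList A ps l)
    (h' : MorleyList A ps l') {m : ℕ} (φ : L.Formula (Fin m ⊕ Fin n)) :
    (∃ a, ∀ c ∈ l, φ.Realize (Sum.elim a c)) ↔ ∃ a, ∀ c ∈ l', φ.Realize (Sum.elim a c) := by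
  classical
  obtain ⟨ι, x, y, s, rfl, rfl, hxy⟩ := h.exists_sameType hps h'
  have hxy' : SameType L x y := hxy.comp Sum.inr
  simpa using hxy'.exists_forall_iff φ s.toFinset id

theorem MorleyList.transfer {A : Set N} {ps : List (GlobalType L N n)}
    (hps : ∀ p ∈ ps, p.IsInvariant A) {ι : Type*} {x y : ι → N}
    (hxy : SameType L (Sum.elim ((↑) : A → N) x) (Sum.elim ((↑) : A → N) y))
    {s : List (Fin n → ι)} (h : MorleyList A ps (s.map (x ∘ ·))) :
    MorleyList A ps (s.map (y ∘ ·)) := by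
  induction s generalizing ps with
  | nil => cases h; exact .nil
  | cons f s ih =>
    cases h with
    | @cons p ps _ _ h hc =>
    refine .cons (ih (fun p hp => hps p (List.mem_cons_of_mem _ hp)) h) ?_
    rw [entries_map] at hc ⊢
    exact hc.transfer (hps p List.mem_cons_self) hxy

theorem below_eq_union_entries (A : Set N) (b : ℕ → Fin n → N) (i : ℕ) :
    below A b i = A ∪ entries ((List.range i).map b).reverse := by
  ext a
  simp [below, entries]

theorem IsMorleySequence.morleyList {q : GlobalType L N n} {A : Set N} {b : ℕ → Fin n → N}
    (h : IsMorleySequence q.formulas A b) (i : ℕ) :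
    MorleyList A (List.replicate i q) ((List.range i).map b).reverse := by
  induction i with
  | zero => exact .nil
  | succ i ih =>
    rw [List.range_succ, List.map_append, List.reverse_append, List.replicate_succ]
    refine .cons ih ?_
    rw [List.append_eq, List.nil_append, ← below_eq_union_entries]
    exact h i

theorem exists_isMorleySequence {κ : Cardinal.{w}} (hκ : Cardinal.aleph0 < κ)
    (hN : IsSaturated L κ N) (q : GlobalType L N n) {A : Set N} (hA : Cardinal.mk A < κ) :
    ∃ b, IsMorleySequence q.formulas A b := by
  have hex : ∀ l : List (Fin n → N), ∃ c, q.Generic (A ∪ entries l) c := fun l =>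
    q.exists_generic hN ((Cardinal.mk_union_le _ _).trans_lt (Cardinal.add_lt_of_lt hκ.le hA
      ((finite_entries l).lt_aleph0.trans hκ)))
  choose f hf using hex
  let g : ℕ → List (Fin n → N) := fun i => Nat.rec [] (fun _ l => f l :: l) i
  have hg : ∀ i, ((List.range i).map fun i => f (g i)).reverse = g i := by
    intro i
    induction i with
    | zero => rfl
    | succ i ih =>
      rw [List.range_succ, List.map_append, List.reverse_append, ih]
      rfl
  refine ⟨fun i => f (g i), fun i => ?_⟩
  rw [below_eq_union_entries, hg]
  exact hf _

end MorleyList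

/-! ### Compactness and Löwenheim–Skolem for SOP₁ -/

section FiniteTrees

variable {L : FirstOrder.Language.{u, v}} {m n : ℕ}

theorem consistent_pair_iff {N : Type*} [L.Structure N] (φ : L.Formula (Fin m ⊕ Fin n))
    (b c : Fin n → N) : Consistent φ ![b, c] ↔
      ∃ a, φ.Realize (Sum.elim a b) ∧ φ.Realize (Sum.elim a c) := by
  constructor
  · intro h
    obtain ⟨a, ha⟩ := h Finset.univ
    exact ⟨a, ha 0 (by simp), ha 1 (by simp)⟩
  · rintro ⟨a, h0, h1⟩ s
    refine ⟨a, fun i _ => ?_⟩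
    fin_cases i
    exacts [h0, h1]

theorem SameType.consistent_iff {ι τ P Q : Type*} [L.Structure P] [L.Structure Q] {x : ι → P}
    {y : ι → Q} (h : SameType L x y) (φ : L.Formula (Fin m ⊕ Fin n)) (s : τ → Fin n → ι) :
    Consistent φ (fun i => x ∘ s i) ↔ Consistent φ (fun i => y ∘ s i) :=
  forall_congr' fun F => h.exists_forall_iff φ F s

theorem SameType.consistent_pair_iff {ι P Q : Type*} [L.Structure P] [L.Structure Q] {x : ι → P}
    {y : ι → Q} (h : SameType L x y) (φ : L.Formula (Fin m ⊕ Fin n)) (s t : Fin n → ι) :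
    Consistent φ ![x ∘ s, x ∘ t] ↔ Consistent φ ![y ∘ s, y ∘ t] := by
  have := h.consistent_iff φ ![s, t]
  convert this using 2 <;>
  · funext i
    fin_cases i <;> rfl

/-- Having SOP₁ passes to elementary substructures that contain the witnessing tree. -/
theorem SameType.formulaSOP1 {P Q : Type*} [L.Structure P] [L.Structure Q]
    {φ : L.Formula (Fin m ⊕ Fin n)} {g : P → Q} (hg : SameType L id g)
    {a : List Bool → Fin n → P}
    (h1 : ∀ η : ℕ → Bool, Consistent φ (fun k : ℕ => g ∘ a ((List.range k).map η)))
    (h2 : ∀ η ν : List Bool, (η ++ [false]) <+: ν → ¬ Consistent φ ![g ∘ a ν, g ∘ a (η ++ [true])]) :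
    FormulaSOP1 P φ := by
  exact ⟨a, fun η => (hg.consistent_iff φ _).2 (h1 η), fun η ν hν h =>
    h2 η ν hν ((hg.consistent_pair_iff φ _ _).1 h)⟩

/-- `SOP1` asks for a model in a fixed universe. The tree has countably many entries, so its Skolem
hull is small enough to be moved there. -/
theorem sop1_of_formulaSOP1 {T : L.Theory} {P : Type w} [L.Structure P] [Nonempty P] [P ⊨ T]
    {φ : L.Formula (Fin m ⊕ Fin n)} (h : FormulaSOP1 P φ) : SOP1 T := by
  obtain ⟨a, h1, h2⟩ := h
  let s : Set P := Set.range fun p : List Bool × Fin n => a p.1 p.2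
  let S := (Substructure.closure (L.sum L.skolem₁) s).elementarySkolem₁Reduct
  have hs : ∀ η t, a η t ∈ S := fun η t => Substructure.subset_closure ⟨(η, t), rfl⟩
  have : Countable s := (Set.countable_range _).to_subtype
  have : Small.{max u v} s := Countable.toSmall _
  have : Small.{max u v} (Substructure.closure (L.sum L.skolem₁) s) := inferInstance
  have : Small.{max u v} S := this
  let e : Shrink.{max u v} S ≃ S := (equivShrink S).symm
  let _ : L.Structure (Shrink.{max u v} S) := e.symm.inducedStructure
  let e' : S ≃[L] Shrink.{max u v} S := e.symm.inducedStructureEquiv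
  have : Nonempty (Shrink.{max u v} S) := e.nonempty
  have : Shrink.{max u v} S ⊨ T := StrongHomClass.theory_model e'
  let g : Shrink.{max u v} S ↪ₑ[L] P := S.subtype.comp e'.symm.toElementaryEmbedding
  have hg : SameType L id g := fun θ => (g.map_formula θ id).symm
  obtain ⟨b, hb⟩ : ∃ b : List Bool → Fin n → Shrink.{max u v} S, ∀ η, g ∘ b η = a η :=
    ⟨fun η t => e.symm ⟨a η t, hs η t⟩, fun η => funext fun t =>
      congrArg Subtype.val (e.apply_symm_apply ⟨a η t, hs η t⟩)⟩
  simp only [← hb] at h1 h2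
  exact ⟨Theory.ModelType.of T (Shrink.{max u v} S), m, n, φ, hg.formulaSOP1 h1 h2⟩

theorem ultraproduct_models {T : L.Theory} {I : Type*} (U : Ultrafilter I) {N : Type*}
    [L.Structure N] [Nonempty N] [N ⊨ T] : (U : Filter I).Product (fun _ => N) ⊨ T :=
  Theory.model_iff _ |>.2 fun _ hσ => (Ultraproduct.sentence_realize _).2
    (Filter.Eventually.of_forall fun _ => Theory.realize_sentence_of_mem T hσ)

theorem realize_ultraproduct {I β γ : Type*} (U : Ultrafilter I) {N : Type*} [L.Structure N]
    [Nonempty N] (θ : L.Formula (β ⊕ γ)) (x : I → β → N) (y : I → γ → N) :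
    θ.Realize (M := (U : Filter I).Product fun _ => N)
      (Sum.elim (fun t => ((fun h => x h t : I → N) : (U : Filter I).Product fun _ => N))
        fun t => ((fun h => y h t : I → N) : (U : Filter I).Product fun _ => N)) ↔
      ∀ᶠ h in (U : Filter I), θ.Realize (Sum.elim (x h) (y h)) := by
  have := Ultraproduct.realize_formula_cast (M := fun _ : I => N) (u := U) θ
    (Sum.elim (fun t h => x h t) fun t h => y h t)
  refine Iff.trans ?_ (this.trans ?_)
  · rw [iff_iff_eq]
    congr 1
    funext z; rcases z with z | z <;> rfl
  · refine Filter.eventually_congr (Filter.Eventually.of_forall fun h => ?_)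
    rw [iff_iff_eq]
    congr 1
    funext z; rcases z with z | z <;> rfl

/-- Compactness for SOP₁: it is enough to find a witnessing tree of every finite height. -/
theorem sop1_of_finite_trees {T : L.Theory} {N : Type w} [L.Structure N] [Nonempty N] [N ⊨ T]
    {φ : L.Formula (Fin m ⊕ Fin n)} (a : ℕ → List Bool → Fin n → N)
    (h1 : ∀ η : List Bool, ∃ x, ∀ ν, ν <+: η → φ.Realize (Sum.elim x (a η.length ν)))
    (h2 : ∀ h (η ν : List Bool), (η ++ [false]) <+: ν → ν.length ≤ h →
      ¬ ∃ x, φ.Realize (Sum.elim x (a h ν)) ∧ φ.Realize (Sum.elim x (a h (η ++ [true])))) :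
    SOP1 T := by
  let U : Ultrafilter ℕ := Filter.hyperfilter ℕ
  let P := (U : Filter ℕ).Product fun _ => N
  have hU : ∀ k, ∀ᶠ h in (U : Filter ℕ), k ≤ h := fun k =>
    Nat.hyperfilter_le_atTop (Filter.eventually_ge_atTop k)
  have : P ⊨ T := ultraproduct_models U
  refine sop1_of_formulaSOP1 (P := P) (φ := φ)
    ⟨fun ν t => ((fun h => a h ν t : ℕ → N) : P), fun η s => ?_, fun η ν hν hc => ?_⟩
  · choose x hx using h1
    -- A branch is solved by the class of the solutions for its initial segments of length `h`.
    refine ⟨fun t => ((fun h => x ((List.range h).map η) t : ℕ → N) : P), fun k hk => ?_⟩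
    refine (realize_ultraproduct U φ (fun h => x ((List.range h).map η)) fun h => a h _).2 ?_
    filter_upwards [hU k] with h hh
    have := hx ((List.range h).map η) ((List.range k).map η) ?_
    · simpa using this
    · refine List.IsPrefix.map _ ?_
      refine ⟨List.range' k (h - k), ?_⟩
      have := List.range'_append_1 (s := 0) (m := k) (n := h - k)
      rwa [Nat.zero_add, Nat.add_sub_cancel' hh, ← List.range_eq_range',
        ← List.range_eq_range'] at this
  · obtain ⟨x, hx1, hx2⟩ := (consistent_pair_iff φ _ _).1 hc
    obtain ⟨y, rfl⟩ : ∃ y : ℕ → Fin m → N, x = fun t => ((fun h => y h t : ℕ → N) : P) := by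
      choose y hy using fun t => Quotient.exists_rep (x t)
      exact ⟨fun h t => y t h, funext fun t => (hy t).symm⟩
    have hx1' := (realize_ultraproduct U φ y fun h => a h ν).1 hx1
    have hx2' := (realize_ultraproduct U φ y fun h => a h (η ++ [true])).1 hx2
    obtain ⟨h, hh1, hh2, hh⟩ := (hx1'.and (hx2'.and (hU ν.length))).exists
    exact h2 h η ν hν hh ⟨_, hh1, hh2⟩

end FiniteTrees

/-! ### Average types, and ultrafilter independence from Kim's lemma -/

section Average

variable {L : FirstOrder.Language.{u, v}} {N : Type w} [L.Structure N] {n : ℕ}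

/-- The average type of an ultrafilter over the whole structure, as a global type. -/
theorem exists_globalType_average [Nonempty N] {I : Set (Fin n → N)} (D : Ultrafilter I) :
    ∃ q : GlobalType L N n, ∀ ψ : L[[N]].Formula (Fin n),
      ψ ∈ q.formulas ↔ ∀ᶠ b : I in (D : Filter I), ψ.Realize (b : Fin n → N) := by
  let P := (D : Filter I).Product fun _ => N
  let _ : L[[N]].Structure P := Ultraproduct.structure
  have : P ⊨ L.elementaryDiagram N := ultraproduct_models D
  refine ⟨(L.elementaryDiagram N).typeOf (M := P) fun t => ((fun b => b.1 t : I → N) : P),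
    fun ψ => ?_⟩
  exact (Theory.CompleteType.formula_mem_typeOf (T := L.elementaryDiagram N)).trans
    (Ultraproduct.realize_formula_cast (M := fun _ : I => N) (u := D) ψ fun t b => b.1 t)

theorem average_inter_eq {I : Set (Fin n → N)} {D : Ultrafilter I} {q : GlobalType L N n}
    (hq : ∀ ψ : L[[N]].Formula (Fin n),
      ψ ∈ q.formulas ↔ ∀ᶠ b : I in (D : Filter I), ψ.Realize (b : Fin n → N)) (A : Set N) :
    average (L := L) D Set.univ ∩ formulasOver n A = q.formulas ∩ formulasOver n A := by
  ext ψ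
  refine and_congr_left fun hψ => ?_
  rw [hq]
  exact and_iff_right (formulasOver_mono (Set.subset_univ A) hψ)

/-- The ultrafilter lives on tuples `b` from `A`, and for these the truth of `θ(b; c)` is decided by
`tp(c/A)`. -/
theorem isInvariant_of_average {A : Set N} {D : Ultrafilter (tuples n A)} {q : GlobalType L N n}
    (hq : ∀ ψ : L[[N]].Formula (Fin n),
      ψ ∈ q.formulas ↔ ∀ᶠ b : tuples n A in (D : Filter _), ψ.Realize (b : Fin n → N)) :
    q.IsInvariant A := by
  intro k θ c c' h
  rw [tp_eq_iff_sameType] at h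
  rw [hq, hq]
  refine Filter.eventually_congr (Filter.Eventually.of_forall fun b => ?_)
  rw [realize_inst, realize_inst]
  refine h.reindex (Sum.elim (fun t => Sum.inr ⟨b.1 t, b.2 t⟩) Sum.inl) ?_ ?_ θ <;>
  · rintro (i | i) <;> rfl

theorem not_isHigher_iff_qDivides {m : ℕ} (φ : L.Formula (Fin m ⊕ Fin n)) {A : Set N}
    {D : Ultrafilter (tuples n A)} {q : GlobalType L N n}
    (hq : ∀ ψ : L[[N]].Formula (Fin n),
      ψ ∈ q.formulas ↔ ∀ᶠ b : tuples n A in (D : Filter _), ψ.Realize (b : Fin n → N)) :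
    ¬ IsHigher φ A D ↔ QDivides φ q A := by
  simp only [IsHigher, QDivides, IsMorleySequence, average_inter_eq hq, not_forall, exists_prop]

/-- Both averages are invariant and extend the type over `A` of a realization `b` of their common
restriction, so Kim's lemma applies to the pair. -/
theorem isHigher_iff_of_kim_lemma [Nonempty N] {κ : Cardinal.{w}} (hN : IsSaturated L κ N) {A : Set N}
    (hA : Cardinal.mk A < κ) {m : ℕ} {φ : L.Formula (Fin m ⊕ Fin n)}
    (hkim : ∀ b : Fin n → N, (∃ q : GlobalType L N n, q.IsInvariant A ∧ tp L b A ⊆ q.formulas ∧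
      QDivides φ q A) → ∀ q : GlobalType L N n, q.IsInvariant A → tp L b A ⊆ q.formulas →
        QDivides φ q A) {D E : Ultrafilter (tuples n A)}
    (hDE : average (L := L) D A = average (L := L) E A) : IsHigher φ A D ↔ IsHigher φ A E := by
  obtain ⟨q, hq⟩ := exists_globalType_average (L := L) D
  obtain ⟨r, hr⟩ := exists_globalType_average (L := L) E
  obtain ⟨b, hb⟩ := q.exists_generic hN hA
  have hav : ∀ {F : Ultrafilter (tuples n A)} {p : GlobalType L N n}, (∀ ψ : L[[N]].Formula (Fin n),
      ψ ∈ p.formulas ↔ ∀ᶠ b : tuples n A in (F : Filter _), ψ.Realize (b : Fin n → N)) →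
      average (L := L) F A = p.formulas ∩ formulasOver n A := by
    intro F p hp
    ext ψ
    rw [Set.inter_comm]
    exact and_congr_right fun _ => (hp ψ).symm
  have hqr : q.formulas ∩ formulasOver n A = r.formulas ∩ formulasOver n A := by
    rw [← hav hq, ← hav hr, hDE]
  have htp : tp L b A ⊆ q.formulas ∩ formulasOver n A := by
    rintro _ ⟨⟨k, θ, a, ha, rfl⟩, hψ⟩
    refine ⟨?_, k, θ, a, ha, rfl⟩
    by_contra hmem
    rw [hq, ← Ultrafilter.eventually_not] at hmem
    have := hb (inst θ.not a) ⟨(hq _).2 (hmem.mono fun c hc => ?_), k, θ.not, a, ha, rfl⟩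
    · rw [realize_inst] at this hψ
      exact this hψ
    · rw [realize_inst] at hc ⊢
      exact hc
  rw [← not_iff_not, not_isHigher_iff_qDivides φ hq, not_isHigher_iff_qDivides φ hr]
  have h1 := htp.trans Set.inter_subset_left
  have h2 := (hqr ▸ htp).trans Set.inter_subset_left
  have i1 := isInvariant_of_average hq
  have i2 := isInvariant_of_average hr
  exact ⟨fun h => hkim b ⟨q, i1, h1, h⟩ r i2 h2, fun h => hkim b ⟨r, i2, h2, h⟩ q i1 h1⟩

end Average

/-! ### Trees of blocks from two invariant types -/

section Trees

variable {n k : ℕ}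

/-- The tuples in the blocks along the path from the root to `η`, starting at the root. -/
def pathList {X : Type*} (a : List Bool → Fin k → Fin n → X) : List Bool → List (Fin n → X)
  | [] => List.ofFn (a [])
  | e :: η => List.ofFn (a []) ++ pathList (fun ν => a (e :: ν)) η

theorem pathList_map {X Y : Type*} (f : X → Y) (a : List Bool → Fin k → Fin n → X)
    (η : List Bool) : pathList (fun ν i => f ∘ a ν i) η = (pathList a η).map (f ∘ ·) := by
  induction η generalizing a with
  | nil => simp [pathList, List.map_ofFn, Function.comp_def]
  | cons e η ih =>
    simp only [pathList, List.map_append, List.map_ofFn, ih fun ν => a (e :: ν)]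
    rfl

theorem mem_pathList_iff {X : Type*} {a : List Bool → Fin k → Fin n → X} {η : List Bool}
    {c : Fin n → X} : c ∈ pathList a η ↔ ∃ ν, ν <+: η ∧ ∃ i, c = a ν i := by
  induction η generalizing a with
  | nil => simp [pathList, List.mem_ofFn, eq_comm]
  | cons e η ih =>
    simp only [pathList, List.mem_append, List.mem_ofFn, ih, List.prefix_cons_iff]
    constructor
    · rintro (⟨i, rfl⟩ | ⟨ν, hν, i, rfl⟩)
      · exact ⟨[], Or.inl rfl, i, rfl⟩
      · exact ⟨e :: ν, Or.inr ⟨ν, rfl, hν⟩, i, rfl⟩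
    · rintro ⟨_, rfl | ⟨ν, rfl, hν⟩, i, rfl⟩
      · exact Or.inl ⟨i, rfl⟩
      · exact Or.inr ⟨ν, hν, i, rfl⟩

variable {L : FirstOrder.Language.{u, v}} {N : Type w} [L.Structure N]

/-- A tree of height `h` of blocks of tuples. The blocks along a path form a Morley list in `r`;
the first tuple of a block to the right realizes `q` over each block above its left neighbour. -/
structure IsBlockTree (A : Set N) (q r : GlobalType L N n) (h : ℕ)
    (a : List Bool → Fin (k + 1) → Fin n → N) : Prop where
  path : ∀ η : List Bool, η.length = h →
    MorleyList A (List.replicate ((h + 1) * (k + 1)) r) (pathList a η)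
  node : ∀ ν : List Bool, ν.length ≤ h →
    MorleyList A (List.replicate (k + 1) r) (List.ofFn (a ν))
  split : ∀ η ν : List Bool, (η ++ [false]) <+: ν → ν.length ≤ h →
    MorleyList A (q :: List.replicate (k + 1) r) (a (η ++ [true]) 0 :: List.ofFn (a ν))

/-- The entries of a tree of blocks, as a single family. -/
def treeFamily {X : Type*} (a : List Bool → Fin k → Fin n → X) :
    List Bool × Fin k × Fin n → X := fun p => a p.1 p.2.1 p.2.2

variable {A : Set N} {q r : GlobalType L N n} {a a' : List Bool → Fin (k + 1) → Fin n → N} {h : ℕ}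

theorem IsBlockTree.transfer (hq : q.IsInvariant A) (hr : r.IsInvariant A)
    (ht : IsBlockTree A q r h a) (haa' : SameType L (Sum.elim ((↑) : A → N) (treeFamily a))
      (Sum.elim ((↑) : A → N) (treeFamily a'))) : IsBlockTree A q r h a' := by
  have hinv : ∀ {i}, ∀ p ∈ List.replicate i r, p.IsInvariant A := fun p hp =>
    List.eq_of_mem_replicate hp ▸ hr
  let s : List Bool → Fin (k + 1) → Fin n → List Bool × Fin (k + 1) × Fin n :=
    fun ν i t => (ν, i, t)
  have h1 : ∀ b : List Bool → Fin (k + 1) → Fin n → N, ∀ η,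
      pathList b η = (pathList s η).map (treeFamily b ∘ ·) := fun b η => by
    rw [← pathList_map]; rfl
  have h2 : ∀ b : List Bool → Fin (k + 1) → Fin n → N, ∀ η,
      List.ofFn (b η) = (List.ofFn (s η)).map (treeFamily b ∘ ·) := fun b η => by
    rw [List.map_ofFn]; rfl
  have h3 : ∀ b : List Bool → Fin (k + 1) → Fin n → N, ∀ η ν,
      b η 0 :: List.ofFn (b ν) = (s η 0 :: List.ofFn (s ν)).map (treeFamily b ∘ ·) := fun b η ν => by
    rw [List.map_cons, ← h2]; rfl
  refine ⟨fun η hη => ?_, fun ν hν => ?_, fun η ν hην hν => ?_⟩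
  · have := ht.path η hη
    rw [h1] at this ⊢
    exact this.transfer hinv haa'
  · have := ht.node ν hν
    rw [h2] at this ⊢
    exact this.transfer hinv haa'
  · have := ht.split η ν hην hν
    rw [h3] at this ⊢
    exact this.transfer (List.forall_mem_cons.2 ⟨hq, hinv⟩) haa'

theorem entries_pathList_subset (a : List Bool → Fin k → Fin n → N) (η : List Bool) :
    entries (pathList a η) ⊆ Set.range (treeFamily a) := by
  rintro _ ⟨c, hc, t, rfl⟩
  obtain ⟨ν, -, i, rfl⟩ := mem_pathList_iff.1 hc
  exact ⟨(ν, i, t), rfl⟩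

theorem entries_ofFn_subset (a : List Bool → Fin k → Fin n → N) (ν : List Bool) :
    entries (List.ofFn (a ν)) ⊆ Set.range (treeFamily a) := by
  rintro _ ⟨c, hc, t, rfl⟩
  obtain ⟨i, rfl⟩ := List.mem_ofFn.1 hc
  exact ⟨(ν, i, t), rfl⟩

theorem MorleyList.exists_ofFn {κ : Cardinal.{w}} (hκ : Cardinal.aleph0 < κ)
    (hN : IsSaturated L κ N) {A : Set N} (hA : Cardinal.mk A < κ) (p : GlobalType L N n) (i : ℕ) :
    ∃ f : Fin i → Fin n → N, MorleyList A (List.replicate i p) (List.ofFn f) := by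
  obtain ⟨l, hl⟩ := MorleyList.exists_of_isSaturated hκ hN hA (List.replicate i p)
  obtain rfl : l.length = i := by simpa using hl.length_eq
  exact ⟨l.get, by simpa using hl⟩

theorem mk_union_range_lt {κ : Cardinal.{w}} (hκ : Cardinal.aleph0 < κ) {A : Set N}
    (hA : Cardinal.mk A < κ) {ι : Type*} [Countable ι] (x : ι → N) :
    Cardinal.mk ↥(A ∪ Set.range x) < κ :=
  (Cardinal.mk_union_le _ _).trans_lt (Cardinal.add_lt_of_lt hκ.le hA
    ((Set.countable_range x).le_aleph0.trans_lt hκ))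

/-- The given tree becomes the left subtree. Let `c` realize `q` over all of it. As `q` and `r`
agree over `A`, saturation yields a conjugate of the tree over `A` whose root block starts with `c`;
it becomes the right subtree. The new root block realizes `r` over both, so it heads the Morley list
of every path. -/
theorem exists_isBlockTree_succ {κ : Cardinal.{w}} (hκ : Cardinal.aleph0 < κ)
    (hN : IsSaturated L κ N) [Nonempty N] (hA : Cardinal.mk A < κ) (hq : q.IsInvariant A)
    (hr : r.IsInvariant A) (hqr : ∀ c c', q.Generic A c → r.Generic A c' →
      SameType L (Sum.elim ((↑) : A → N) c') (Sum.elim ((↑) : A → N) c))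
    (ht : IsBlockTree A q r h a) :
    ∃ a' : List Bool → Fin (k + 1) → Fin n → N, IsBlockTree A q r (h + 1) a' := by
  obtain ⟨c, hc⟩ := q.exists_generic hN (mk_union_range_lt hκ hA (treeFamily a))
  have hroot : r.Generic A (a [] 0) := by
    have := ht.node [] (Nat.zero_le _)
    rw [List.ofFn_succ, List.replicate_succ] at this
    cases this with
    | cons _ hc => exact hc.mono Set.subset_union_left
  obtain ⟨y, hy⟩ := hN.exists_family hκ (hqr _ _ (hc.mono Set.subset_union_left) hroot) (by
    rw [Set.Sum.elim_range, Subtype.range_coe]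
    exact mk_union_range_lt hκ hA c) (treeFamily a) (by
      rw [Cardinal.lift_uzero]
      exact (Cardinal.lift_le_aleph0.2 Cardinal.mk_le_aleph0).trans_lt hκ)
  let b : List Bool → Fin (k + 1) → Fin n → N := fun ν i t => y (ν, i, t)
  have hb0 : b [] 0 = c := funext fun t =>
    hy.eq_of_eq (i := Sum.inr ([], 0, t)) (j := Sum.inl (Sum.inr t)) rfl
  have htb : IsBlockTree A q r h b := ht.transfer hq hr
    (hy.reindex (Sum.map Sum.inl id) (by rintro (i | i) <;> rfl) (by rintro (i | i) <;> rfl))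
  obtain ⟨f, hf⟩ := MorleyList.exists_ofFn hκ hN
    (mk_union_range_lt hκ (mk_union_range_lt hκ hA (treeFamily a)) (treeFamily b)) r (k + 1)
  have hfa : ∀ e : Bool, A ∪ Set.range (treeFamily (if e then b else a)) ⊆
      A ∪ Set.range (treeFamily a) ∪ Set.range (treeFamily b) := by
    rintro (_ | _) z (hz | hz)
    exacts [Or.inl (Or.inl hz), Or.inl (Or.inr hz), Or.inl (Or.inl hz), Or.inr hz]
  have hte : ∀ e : Bool, IsBlockTree A q r h (if e then b else a) := by
    rintro (_ | _)
    exacts [ht, htb]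
  let a' : List Bool → Fin (k + 1) → Fin n → N := fun ν => match ν with
    | [] => f
    | e :: ν => (if e then b else a) ν
  refine ⟨a', ⟨fun η hη => ?_, fun ν hν => ?_, fun η ν hην hν => ?_⟩⟩
  · cases η with
    | nil => simp at hη
    | cons e η =>
      have := ((hte e).path η (by simpa using hη)).append (hf.mono ((Set.union_subset_union_right _
        (entries_pathList_subset _ η)).trans (hfa e)))
      rw [List.replicate_append_replicate] at this
      rw [show (h + 1 + 1) * (k + 1) = k + 1 + (h + 1) * (k + 1) by ring]
      exact this
  · cases ν with
    | nil => exact hf.mono fun z hz => Or.inl (Or.inl hz)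
    | cons e ν => exact (hte e).node ν (by simpa using hν)
  · cases ν with
    | nil => simp at hην
    | cons e ν =>
      cases η with
      | nil =>
        obtain rfl : e = false := by simpa [eq_comm] using hην
        refine .cons (ht.node ν (by simpa using hν)) ?_
        change q.Generic _ (b [] 0)
        rw [hb0]
        exact hc.mono (Set.union_subset_union_right _ (entries_ofFn_subset a ν))
      | cons e' η =>
        rw [List.cons_append, List.cons_prefix_cons] at hην
        obtain ⟨rfl, hην⟩ := hην
        exact (hte e').split η ν hην (by simpa using hν)

theorem exists_isBlockTree {κ : Cardinal.{w}} (hκ : Cardinal.aleph0 < κ)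
    (hN : IsSaturated L κ N) [Nonempty N] (hA : Cardinal.mk A < κ) (hq : q.IsInvariant A)
    (hr : r.IsInvariant A) (hqr : ∀ c c', q.Generic A c → r.Generic A c' →
      SameType L (Sum.elim ((↑) : A → N) c') (Sum.elim ((↑) : A → N) c)) (k h : ℕ) :
    ∃ a : List Bool → Fin (k + 1) → Fin n → N, IsBlockTree A q r h a := by
  induction h with
  | zero =>
    obtain ⟨f, hf⟩ := MorleyList.exists_ofFn hκ hN hA r (k + 1)
    refine ⟨fun _ => f, ⟨fun η hη => ?_, fun _ _ => hf, fun η ν hην hν => ?_⟩⟩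
    · rw [List.length_eq_zero_iff] at hη
      subst hη
      simpa [pathList] using hf
    · have := hην.length_le
      simp at this
      omega
  | succ h ih =>
    obtain ⟨a, ha⟩ := ih
    exact exists_isBlockTree_succ hκ hN hA hq hr hqr ha

end Trees

/-! ### SOP₁ from a failure of Kim's lemma -/

section KimLemma

variable {L : FirstOrder.Language.{u, v}} {N : Type w} [L.Structure N] {m n : ℕ}

theorem GlobalType.Generic.sameType_of_tp_subset {A : Set N} {b c : Fin n → N}
    {q : GlobalType L N n} (hq : tp L b A ⊆ q.formulas) (hc : q.Generic A c) :
    SameType L (Sum.elim ((↑) : A → N) b) (Sum.elim ((↑) : A → N) c) := by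
  have : SameType L (Sum.elim b ((↑) : A → N)) (Sum.elim c ((↑) : A → N)) := by
    refine SameType.of_forall_fin fun k s => SameType.of_imp fun θ hθ => ?_
    have hmem : inst θ ((↑) ∘ s) ∈ formulasOver n A := ⟨k, θ, _, fun i => (s i).2, rfl⟩
    exact (realize_inst _ _ _).1 (hc _ ⟨hq ⟨hmem, (realize_inst _ _ _).2 hθ⟩, hmem⟩)
  exact this.reindex Sum.swap (by rintro (i | i) <;> rfl) (by rintro (i | i) <;> rfl)

/-- The formula `⋀ i, φ(x; y i)`. -/
noncomputable def conj (φ : L.Formula (Fin m ⊕ Fin n)) (k : ℕ) :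
    L.Formula (Fin m ⊕ Fin (k * n)) :=
  Formula.iInf fun i : Fin k => φ.relabel (Sum.map id fun t => finProdFinEquiv (i, t))

theorem realize_conj (φ : L.Formula (Fin m ⊕ Fin n)) (k : ℕ) (x : Fin m → N)
    (y : Fin k → Fin n → N) :
    (conj φ k).Realize (Sum.elim x fun j => y (finProdFinEquiv.symm j).1 (finProdFinEquiv.symm j).2) ↔
      ∀ i, φ.Realize (Sum.elim x (y i)) := by
  unfold conj
  rw [Formula.realize_iInf]
  refine forall_congr' fun i => ?_
  rw [Formula.realize_relabel, iff_iff_eq]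
  congr 1
  funext z
  rcases z with z | z
  · rfl
  · simp only [Function.comp_apply, Sum.map_inr, Sum.elim_inr, Equiv.symm_apply_apply]

variable {A : Set N} {q r : GlobalType L N n}

/-- The formula `φ` is consistent along realizations of `i` copies of `r` followed by `l` copies
of `q`. -/
def ConsistentAlong (A : Set N) (q r : GlobalType L N n) (φ : L.Formula (Fin m ⊕ Fin n))
    (i l : ℕ) : Prop :=
  ∃ s, MorleyList A (List.replicate l q ++ List.replicate i r) s ∧
    ∃ x, ∀ c ∈ s, φ.Realize (Sum.elim x c)

theorem MorleyList.consistentAlong_iff (hq : q.IsInvariant A) (hr : r.IsInvariant A)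
    (φ : L.Formula (Fin m ⊕ Fin n)) {i l : ℕ} {s : List (Fin n → N)}
    (hs : MorleyList A (List.replicate l q ++ List.replicate i r) s) :
    ConsistentAlong A q r φ i l ↔ ∃ x, ∀ c ∈ s, φ.Realize (Sum.elim x c) := by
  have hinv : ∀ p ∈ List.replicate l q ++ List.replicate i r, p.IsInvariant A := by
    intro p hp
    rcases List.mem_append.1 hp with hp | hp
    exacts [List.eq_of_mem_replicate hp ▸ hq, List.eq_of_mem_replicate hp ▸ hr]
  constructor
  · rintro ⟨s', hs', h⟩
    exact (hs'.consistent_iff hinv hs φ).1 h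
  · exact fun h => ⟨s, hs, h⟩

/-- If dividing along invariant types depends on the type chosen, then the theory has SOP₁. -/
theorem sop1_of_qDivides {T : L.Theory} [Nonempty N] [N ⊨ T] {κ : Cardinal.{w}}
    (hκ : Cardinal.aleph0 < κ) (hN : IsSaturated L κ N) (hA : Cardinal.mk A < κ)
    (hq : q.IsInvariant A) (hr : r.IsInvariant A) {b : Fin n → N} (hbq : tp L b A ⊆ q.formulas)
    (hbr : tp L b A ⊆ r.formulas) {φ : L.Formula (Fin m ⊕ Fin n)} (hφq : QDivides φ q A)
    (hφr : ¬ QDivides φ r A) : SOP1 T := by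
  classical
  have hqr : ∀ c c', q.Generic A c → r.Generic A c' →
      SameType L (Sum.elim ((↑) : A → N) c') (Sum.elim ((↑) : A → N) c) := fun c c' hc hc' =>
    (hc'.sameType_of_tp_subset hbr).symm.trans (hc.sameType_of_tp_subset hbq)
  have hcr : ∀ i, ConsistentAlong A q r φ i 0 := by
    intro i
    obtain ⟨d, hd⟩ := exists_isMorleySequence hκ hN r hA
    have hcons : Consistent φ d := by
      by_contra hcons
      exact hφr ⟨d, hd, hcons⟩
    obtain ⟨x, hx⟩ := hcons (Finset.range i)
    exact ⟨_, hd.morleyList i, x, by simpa using hx⟩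
  have hcq : ∃ l, ∃ i, ¬ ConsistentAlong A q r φ i l := by
    obtain ⟨d, hd, hcons⟩ := hφq
    simp only [Consistent, not_forall] at hcons
    obtain ⟨s, hs⟩ := hcons
    refine ⟨s.sup id + 1, 0, fun h => hs ?_⟩
    obtain ⟨x, hx⟩ := (MorleyList.consistentAlong_iff hq hr φ (i := 0)
      (by simpa using hd.morleyList (s.sup id + 1))).1 h
    refine ⟨x, fun i hi => hx _ ?_⟩
    simp only [List.mem_reverse, List.mem_map, List.mem_range]
    exact ⟨i, Nat.lt_succ_of_le (Finset.le_sup (f := id) hi), rfl⟩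
  -- The least number of `q`'s is positive, because `φ` does not divide along `r`.
  obtain ⟨l, hl⟩ : ∃ l, Nat.find hcq = l + 1 := by
    refine Nat.exists_eq_succ_of_ne_zero fun h0 => ?_
    obtain ⟨i, hi⟩ := Nat.find_spec hcq
    rw [h0] at hi
    exact hi (hcr i)
  have hcl : ∀ i, ConsistentAlong A q r φ i l := fun i => by
    by_contra hi
    exact Nat.find_min hcq (m := l) (by omega) ⟨i, hi⟩
  obtain ⟨k, hk⟩ := Nat.find_spec hcq
  rw [hl] at hk
  -- One more `r` at the start keeps the inconsistency. It makes the blocks nonempty, so that each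
  -- has a first tuple.
  have hk' : ¬ ConsistentAlong A q r φ (k + 1) (l + 1) := by
    intro hcons
    obtain ⟨c, hc⟩ := MorleyList.exists_of_isSaturated hκ hN hA [r]
    obtain ⟨s, hs⟩ := MorleyList.exists_of_isSaturated hκ hN (A := A ∪ entries c)
      ((Cardinal.mk_union_le _ _).trans_lt (Cardinal.add_lt_of_lt hκ.le hA
        ((finite_entries c).lt_aleph0.trans hκ)))
      (List.replicate (l + 1) q ++ List.replicate k r)
    have hsc := hc.append hs
    rw [List.append_assoc, ← List.replicate_succ'] at hsc
    obtain ⟨x, hx⟩ := (hsc.consistentAlong_iff hq hr φ).1 hcons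
    exact hk ⟨s, hs.mono Set.subset_union_left, x, fun d hd =>
      hx d (List.mem_append_left _ hd)⟩
  choose a ha using exists_isBlockTree hκ hN hA hq hr hqr k
  choose f hf using fun h => MorleyList.exists_ofFn hκ hN
    (mk_union_range_lt hκ hA (treeFamily (a h))) q l
  let d : ℕ → List Bool → Fin (k + 1 + l) → Fin n → N := fun h ν => Fin.append (a h ν) (f h)
  have hd : ∀ h ν x, (∀ i, φ.Realize (Sum.elim x (d h ν i))) ↔
      (∀ i, φ.Realize (Sum.elim x (a h ν i))) ∧ ∀ i, φ.Realize (Sum.elim x (f h i)) := by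
    intro h ν x
    constructor
    · intro H
      exact ⟨fun i => by simpa [d] using H (Fin.castAdd l i),
        fun i => by simpa [d] using H (Fin.natAdd (k + 1) i)⟩
    · rintro ⟨H1, H2⟩ i
      refine Fin.addCases (fun i => ?_) (fun i => ?_) i
      · simpa [d] using H1 i
      · simpa [d] using H2 i
  refine sop1_of_finite_trees (N := N) (φ := conj φ (k + 1 + l)) (fun h ν j =>
    d h ν (finProdFinEquiv.symm j).1 (finProdFinEquiv.symm j).2) (fun η => ?_)
    (fun h η ν hην hν => ?_)
  · have hm := ((ha η.length).path η rfl).append ((hf η.length).mono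
      (Set.union_subset_union_right _ (entries_pathList_subset _ η)))
    obtain ⟨x, hx⟩ := (hm.consistentAlong_iff hq hr φ).1 (hcl _)
    refine ⟨x, fun ν hν => ?_⟩
    rw [realize_conj, hd]
    exact ⟨fun i => hx _ (List.mem_append_right _ (mem_pathList_iff.2 ⟨ν, hν, i, rfl⟩)),
      fun i => hx _ (List.mem_append_left _ (List.mem_ofFn.2 ⟨i, rfl⟩))⟩
  · rintro ⟨x, hx1, hx2⟩
    rw [realize_conj, hd] at hx1 hx2
    have hm := ((ha h).split η ν hην hν).append ((hf h).mono (Set.union_subset_union_right _ (by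
      rw [entries_cons]
      refine Set.union_subset ?_ (entries_ofFn_subset _ _)
      rintro _ ⟨t, rfl⟩
      exact ⟨(η ++ [true], 0, t), rfl⟩)))
    -- The right child's first tuple joins the `l` common realizations of `q`: above the block at
    -- `ν` there are now `l + 1` of them.
    rw [← List.singleton_append (l := List.replicate (k + 1) r), ← List.append_assoc,
      ← List.replicate_succ'] at hm
    refine hk' ((hm.consistentAlong_iff hq hr φ).2 ⟨x, fun c hc => ?_⟩)
    simp only [List.mem_append, List.mem_cons, List.mem_ofFn] at hc
    rcases hc with ⟨i, rfl⟩ | rfl | ⟨i, rfl⟩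
    exacts [hx1.2 i, hx2.1 0, hx1.1 i]

end KimLemma

/-! ### Extracting a two-column array from a tree -/

section Array

/-- The sequence `c`, with default value `d` from the index `i` on. -/
def truncate {X : Type*} (d : X) (c : ℕ → X) (i : ℕ) : ℕ → X := fun j => if j < i then c j else d

/-- From a binary tree and finitely many properties, the pigeonhole principle extracts an array
whose rows agree on these properties relative to the previous rows. The left column of the array
lies on a path; the right column turns right where the later rows turn left. -/
theorem exists_array {X Θ : Type*} (a : List Bool → X) (d : Bool → X) (Δ : Finset Θ)
    (χ : Θ → (ℕ → Bool → X) → X → Prop) : ∃ c : ℕ → Bool → X,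
      (∀ i, ∀ θ ∈ Δ, χ θ (truncate d c i) (c i false) ↔ χ θ (truncate d c i) (c i true)) ∧
      (∀ i, ∃ μ : List Bool, ∀ j < i, ∃ ν, ν <+: μ ∧ c j false = a ν) ∧
      (∀ i j, i < j → ∃ η ν : List Bool, (η ++ [false]) <+: ν ∧ c i true = a (η ++ [true]) ∧
        c j true = a ν) := by
  classical
  -- Infinitely many nodes `ν⌢0^i⌢1` turn right off the leftmost path above `ν`, with finitely many
  -- truth patterns on `Δ`.
  have step : ∀ (ν : List Bool) (H : ℕ → Bool → X), ∃ p : ℕ × ℕ, p.1 < p.2 ∧ ∀ θ ∈ Δ,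
      χ θ H (a (ν ++ List.replicate p.2 false ++ [true])) ↔
        χ θ H (a (ν ++ List.replicate p.1 false ++ [true])) := by
    intro ν H
    obtain ⟨i, j, hij, hf⟩ := Finite.exists_ne_map_eq_of_infinite
      fun (i : ℕ) (θ : Δ) => χ θ H (a (ν ++ List.replicate i false ++ [true]))
    rcases hij.lt_or_gt with h | h
    · exact ⟨(i, j), h, fun θ hθ => iff_of_eq (congrFun hf ⟨θ, hθ⟩).symm⟩
    · exact ⟨(j, i), h, fun θ hθ => iff_of_eq (congrFun hf ⟨θ, hθ⟩)⟩
  choose p hp hχ using step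
  -- The left entry is the later turn-off, so it lies above the left child of the node where the
  -- right entry turns off; the next row starts from the left entry.
  let left : List Bool × (ℕ → Bool → X) → List Bool :=
    fun σ => σ.1 ++ List.replicate (p σ.1 σ.2).2 false ++ [true]
  let right : List Bool × (ℕ → Bool → X) → List Bool :=
    fun σ => σ.1 ++ List.replicate (p σ.1 σ.2).1 false
  let row : List Bool × (ℕ → Bool → X) → Bool → X :=
    fun σ e => bif e then a (right σ ++ [true]) else a (left σ)
  let σ : ℕ → List Bool × (ℕ → Bool → X) := fun i =>
    Nat.rec ([], fun _ => d) (fun i σ => (left σ, Function.update σ.2 i (row σ))) i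
  have hσ : ∀ i, σ (i + 1) = (left (σ i), Function.update (σ i).2 i (row (σ i))) := fun i => rfl
  have htr : ∀ i, (σ i).2 = truncate d (fun i => row (σ i)) i := by
    intro i
    induction i with
    | zero => funext j; simp [truncate, σ]
    | succ i ih =>
      funext j
      rw [hσ]
      simp only [Function.update_apply, ih]
      by_cases hji : j = i
      · simp [truncate, hji]
      · simp only [truncate, hji, if_false]
        have : j < i ↔ j < i + 1 := by omega
        simp only [this]
  have hleft : ∀ i, (σ i).1 <+: left (σ i) := fun i =>
    (List.prefix_append _ _).trans (List.prefix_append _ _)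
  have hmono : ∀ i j, i ≤ j → (σ i).1 <+: (σ j).1 := by
    intro i j hij
    induction j, hij using Nat.le_induction with
    | base => exact List.prefix_rfl
    | succ j _ ih => exact ih.trans (hleft j)
  refine ⟨fun i => row (σ i), fun i θ hθ => ?_, fun i => ⟨(σ i).1, fun j hj => ?_⟩,
    fun i j hij => ⟨right (σ i), right (σ j) ++ [true], ?_, rfl, rfl⟩⟩
  · rw [← htr]
    exact hχ _ _ θ hθ
  · exact ⟨(σ (j + 1)).1, hmono _ _ hj, rfl⟩
  · have h1 : right (σ i) ++ [false] <+: (σ (i + 1)).1 := by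
      rw [hσ]
      simp only [left, right, List.append_assoc]
      rw [List.prefix_append_right_inj]
      obtain ⟨k, hk⟩ := Nat.exists_eq_add_of_lt (hp (σ i).1 (σ i).2)
      rw [hk, Nat.add_assoc, ← List.replicate_append_replicate, List.append_assoc,
        List.prefix_append_right_inj, List.replicate_succ]
      simp
    exact h1.trans ((hmono _ _ hij).trans
      ((List.prefix_append _ _).trans (List.prefix_append _ _)))

end Array

/-! ### Terms, bounded formulas and finite branches -/

section Transfer

variable {L : FirstOrder.Language.{u, v}}

theorem realize_term_congr {α N : Type*} [L.Structure N] [DecidableEq α] (t : L.Term α)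
    {x y : α → N} (h : ∀ i ∈ t.varFinset, x i = y i) : t.realize x = t.realize y := by
  induction t with
  | var i => exact h i (by simp [Term.varFinset])
  | func f ts ih =>
    simp only [Term.realize_func]
    congr 1
    funext i
    exact ih i fun j hj => h j (by
      simp only [Term.varFinset, Finset.mem_biUnion, Finset.mem_univ, true_and]
      exact ⟨i, hj⟩)

theorem SameType.boundedFormula_iff {ι P Q : Type*} [L.Structure P] [L.Structure Q] {x : ι → P}
    {y : ι → Q} (h : SameType L x y) {k : ℕ} (ψ : L.BoundedFormula Empty k) (t : Fin k → ι) :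
    ψ.Realize default (x ∘ t) ↔ ψ.Realize default (y ∘ t) := by
  have := h (ψ.toFormula.relabel (Sum.elim Empty.elim t))
  rw [Formula.realize_relabel, Formula.realize_relabel, BoundedFormula.realize_toFormula,
    BoundedFormula.realize_toFormula] at this
  convert this using 2 <;> rfl

/-- Continue `μ` by zeros to an infinite branch. -/
theorem FormulaSOP1.exists_forall_prefix {N : Type*} [L.Structure N] {m n : ℕ}
    {φ : L.Formula (Fin m ⊕ Fin n)} {a : List Bool → Fin n → N}
    (h : ∀ η : ℕ → Bool, Consistent φ (fun k : ℕ => a ((List.range k).map η))) (μ : List Bool) :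
    ∃ x, ∀ ν, ν <+: μ → φ.Realize (Sum.elim x (a ν)) := by
  obtain ⟨x, hx⟩ := h (fun i => μ.getD i false) (Finset.range (μ.length + 1))
  refine ⟨x, fun ν hν => ?_⟩
  have := hx ν.length (by simpa using Nat.lt_succ_of_le hν.length_le)
  convert this using 3
  obtain ⟨τ, rfl⟩ := hν
  refine List.ext_getElem (by simp) fun i h1 h2 => ?_
  simp only [List.getElem_map, List.getElem_range, List.getD_append _ _ _ _ h1,
    List.getD_eq_getElem _ _ h1]

end Transfer

/-! ### Arrays over their own Skolem hull -/

section SkolemArray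

variable {L : FirstOrder.Language.{u, v}} {m n : ℕ}

/-- The range of `w` is closed under Skolem functions, and `c` is an array of tuples in it, whose
two columns have the same limit over this range. The formula `φ` is consistent along the left
column, and inconsistent along the right one. -/
structure IsSkolemArray (φ : L.Formula (Fin m ⊕ Fin n)) {Y P : Type*} [L.Structure P] (w : Y → P)
    (c : ℕ → Bool → Fin n → Y) : Prop where
  skolem : ∀ (k : ℕ) (ψ : L.BoundedFormula Empty (k + 1)) (t : Fin k → Y), ∃ t', ∀ a,
    ψ.Realize default (Fin.snoc (w ∘ t) a : Fin (k + 1) → P) →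
      ψ.Realize default (Fin.snoc (w ∘ t) (w t') : Fin (k + 1) → P)
  eventually_iff : ∀ (k : ℕ) (θ : L.Formula (Fin n ⊕ Fin k)) (t : Fin k → Y),
    ∀ᶠ i in Filter.atTop, θ.Realize (Sum.elim (w ∘ c i false) (w ∘ t)) ↔
      θ.Realize (Sum.elim (w ∘ c i true) (w ∘ t))
  consistent : Consistent φ fun i => w ∘ c i false
  inconsistent : ∀ i j, i < j → ¬ Consistent φ ![w ∘ c i true, w ∘ c j true]

/-- All clauses are expressed by formulas. In the Skolem clause an element of `Q` need not have a
counterpart in `P`, so the argument passes through `ψ.ex`. -/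
theorem IsSkolemArray.transfer {φ : L.Formula (Fin m ⊕ Fin n)} {Y P Q : Type*} [L.Structure P]
    [L.Structure Q] {x : Y → P} {y : Y → Q} (hxy : SameType L x y) {c : ℕ → Bool → Fin n → Y}
    (h : IsSkolemArray φ x c) : IsSkolemArray φ y c := by
  have hθ : ∀ (k : ℕ) (θ : L.Formula (Fin n ⊕ Fin k)) (s : Fin n → Y) (t : Fin k → Y),
      θ.Realize (Sum.elim (x ∘ s) (x ∘ t)) ↔ θ.Realize (Sum.elim (y ∘ s) (y ∘ t)) := by
    intro k θ s t
    refine hxy.reindex (Sum.elim s t) ?_ ?_ θ <;>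
    · rintro (i | i) <;> rfl
  refine ⟨fun k ψ t => ?_, fun k θ t => ?_, (hxy.consistent_iff φ _).1 h.consistent,
    fun i j hij => mt (hxy.consistent_pair_iff φ _ _).2 (h.inconsistent i j hij)⟩
  · obtain ⟨t', ht'⟩ := h.skolem k ψ t
    refine ⟨t', fun a ha => ?_⟩
    have h1 : ψ.ex.Realize default (x ∘ t) :=
      (hxy.boundedFormula_iff ψ.ex t).2 (BoundedFormula.realize_ex.2 ⟨a, ha⟩)
    obtain ⟨b, hb⟩ := BoundedFormula.realize_ex.1 h1
    have h2 := ht' b hb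
    rw [← Fin.comp_snoc] at h2 ⊢
    exact (hxy.boundedFormula_iff ψ _).1 h2
  · simpa only [hθ] using h.eventually_iff k θ t

/-- A formula with SOP₁ has a Skolem array in some model, indexed by Skolem terms. -/
theorem exists_isSkolemArray {T : L.Theory} {N : Type z} [L.Structure N] [Nonempty N]
    [N ⊨ T] {φ : L.Formula (Fin m ⊕ Fin n)} (h : FormulaSOP1 N φ) :
    ∃ (P : Type (max u v z)) (_ : L.Structure P) (_ : Nonempty P) (_ : P ⊨ T)
      (e : (L.sum L.skolem₁).Term (ℕ × Bool × Fin n) → P), IsSkolemArray φ e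
        fun i b t => Term.var (i, b, t) := by
  classical
  obtain ⟨a, h1, h2⟩ := h
  let V := ℕ × Bool × Fin n
  let Θ := Σ k, L.Formula (Fin n ⊕ Fin k) × (Fin k → (L.sum L.skolem₁).Term V)
  let ev : (ℕ → Bool → Fin n → N) → V → N := fun H p => H p.1 p.2.1 p.2.2
  let χ : Θ → (ℕ → Bool → Fin n → N) → (Fin n → N) → Prop := fun θ H b =>
    θ.2.1.Realize (Sum.elim b fun i => (θ.2.2 i).realize (ev H))
  choose c hc1 hc2 hc3 using fun Δ : Finset Θ => exists_array a (fun _ => a []) Δ χ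
  -- Every condition in `Θ` belongs to `U`-almost all `Δ`.
  let U : Ultrafilter (Finset Θ) := Ultrafilter.of Filter.atTop
  have hU : (U : Filter (Finset Θ)) ≤ Filter.atTop := Ultrafilter.of_le _
  let P := (U : Filter (Finset Θ)).Product fun _ => N
  have hP : P ⊨ T := ultraproduct_models U
  let e : (L.sum L.skolem₁).Term V → P := fun t => ((fun Δ => t.realize (ev (c Δ)) : _ → N) : P)
  have hlos : ∀ (k : ℕ) (ψ : L.BoundedFormula Empty (k + 1))
      (t : Fin k → (L.sum L.skolem₁).Term V) (b : Finset Θ → N),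
      ψ.Realize default (Fin.snoc (e ∘ t) (b : P) : Fin (k + 1) → P) ↔
        ∀ᶠ Δ in (U : Filter (Finset Θ)), ψ.Realize default
          (Fin.snoc (fun i => (t i).realize (ev (c Δ))) (b Δ) : Fin (k + 1) → N) := by
    intro k ψ t b
    have := Ultraproduct.boundedFormula_realize_cast (M := fun _ : Finset Θ => N) (u := U) ψ
      Empty.elim (Fin.snoc (fun i Δ => (t i).realize (ev (c Δ))) b : Fin (k + 1) → Finset Θ → N)
    refine Iff.trans ?_ (this.trans ?_)
    · rw [iff_iff_eq]
      congr 1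
      · exact Subsingleton.elim _ _
      · funext i
        refine Fin.lastCases ?_ (fun i => ?_) i
        · refine (Fin.snoc_last (α := fun _ => P) _ _).trans ?_
          rw [Fin.snoc_last]
        · refine (Fin.snoc_castSucc (α := fun _ => P) _ _ _).trans ?_
          rw [Fin.snoc_castSucc]
          rfl
    · refine Filter.eventually_congr (Filter.Eventually.of_forall fun Δ => ?_)
      rw [iff_iff_eq]
      congr 1
      · exact Subsingleton.elim _ _
      · funext i
        refine Fin.lastCases ?_ (fun i => ?_) i <;> simp
  refine ⟨P, inferInstance, inferInstance, hP, e, fun k ψ t => ?_, fun k θ t => ?_, fun F => ?_,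
    fun i j hij hcons => ?_⟩
  · refine ⟨Term.func (LHom.sumInr.onFunction ψ) t, fun b hb => ?_⟩
    obtain ⟨b, rfl⟩ := Quotient.exists_rep b
    refine (hlos k ψ t _).2 (((hlos k ψ t b).1 hb).mono fun Δ hΔ => ?_)
    exact Classical.epsilon_spec (p := fun a => ψ.Realize default
      (Fin.snoc (fun i => (t i).realize (ev (c Δ))) a : Fin (k + 1) → N)) ⟨b Δ, hΔ⟩
  · filter_upwards [Filter.eventually_gt_atTop
      (Finset.univ.sup fun s => (t s).varFinset.sup Prod.fst)] with i hi
    have hr : ∀ b, θ.Realize (Sum.elim (e ∘ fun s => Term.var (i, b, s)) (e ∘ t)) ↔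
        ∀ᶠ Δ in (U : Filter (Finset Θ)),
          θ.Realize (Sum.elim (c Δ i b) fun s => (t s).realize (ev (c Δ))) := fun b =>
      realize_ultraproduct U θ (fun Δ => c Δ i b) fun Δ s => (t s).realize (ev (c Δ))
    rw [hr, hr]
    refine Filter.eventually_congr ?_
    filter_upwards [hU (Filter.eventually_ge_atTop {(⟨k, θ, t⟩ : Θ)})] with Δ hΔ
    have := hc1 Δ i ⟨k, θ, t⟩ (hΔ (Finset.mem_singleton_self _))
    have ht : ∀ s, (t s).realize (ev (truncate (fun _ => a []) (c Δ) i)) =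
        (t s).realize (ev (c Δ)) := by
      refine fun s => realize_term_congr _ fun p hp => ?_
      have hpi : p.1 < i := lt_of_le_of_lt ((Finset.le_sup (f := Prod.fst) hp).trans
        (Finset.le_sup (f := fun s => (t s).varFinset.sup Prod.fst) (Finset.mem_univ s))) hi
      simp [ev, truncate, hpi]
    simpa only [χ, ht] using this
  · choose μ hμ using fun Δ => hc2 Δ (F.sup id + 1)
    choose x hx using FormulaSOP1.exists_forall_prefix h1
    refine ⟨fun s => ((fun Δ => x (μ Δ) s : Finset Θ → N) : P), fun i hi => ?_⟩
    refine (realize_ultraproduct U φ (fun Δ => x (μ Δ)) fun Δ => c Δ i false).2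
      (Filter.Eventually.of_forall fun Δ => ?_)
    obtain ⟨ν, hν, hcν⟩ := hμ Δ i (Nat.lt_succ_of_le (Finset.le_sup (f := id) hi))
    rw [hcν]
    exact hx _ ν hν
  · obtain ⟨x, hx1, hx2⟩ := (consistent_pair_iff φ _ _).1 hcons
    obtain ⟨y, rfl⟩ : ∃ y : Finset Θ → Fin m → N,
        x = fun s => ((fun Δ => y Δ s : Finset Θ → N) : P) := by
      choose y hy using fun s => Quotient.exists_rep (x s)
      exact ⟨fun Δ s => y s Δ, funext fun s => (hy s).symm⟩
    have hx1' := (realize_ultraproduct U φ y fun Δ => c Δ i true).1 hx1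
    have hx2' := (realize_ultraproduct U φ y fun Δ => c Δ j true).1 hx2
    obtain ⟨Δ, hΔ1, hΔ2⟩ := (hx1'.and hx2').exists
    obtain ⟨η, ν, hην, hi, hj⟩ := hc3 Δ i j hij
    rw [hi] at hΔ1
    rw [hj] at hΔ2
    exact h2 η ν hην ((consistent_pair_iff φ _ _).2 ⟨_, hΔ2, hΔ1⟩)

/-- Smallness of the set of Skolem terms allows the hull to be realized in the monster as a model of
size less than `κ`. -/
theorem mk_term_lt {κ : Cardinal.{w}} (hκ : Cardinal.aleph0 < κ)
    (hL : Cardinal.lift.{w} L.card < Cardinal.lift.{max u v} κ) {V : Type} [Countable V] :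
    Cardinal.lift.{w} (Cardinal.mk ((L.sum L.skolem₁).Term V)) < Cardinal.lift.{max u v} κ := by
  have h1 : Cardinal.mk ((L.sum L.skolem₁).Term V) ≤ max Cardinal.aleph0 L.card := by
    refine Term.card_le.trans (max_le (le_max_left _ _) ?_)
    rw [Cardinal.mk_sum]
    refine Cardinal.add_le_of_le (le_max_left _ _) ?_ ?_
    · exact (Cardinal.lift_le_aleph0.2 Cardinal.mk_le_aleph0).trans (le_max_left _ _)
    · rw [Cardinal.lift_uzero]
      exact card_functions_sum_skolem₁_le
  refine (Cardinal.lift_le.2 h1).trans_lt ?_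
  rw [Cardinal.lift_max, Cardinal.lift_aleph0]
  refine max_lt ?_ hL
  rw [← Cardinal.lift_aleph0.{max u v, w}]
  exact Cardinal.lift_lt.2 hκ

end SkolemArray

/-! ### SOP₁ refutes ultrafilter independence -/

section UltrafilterIndependence

variable {L : FirstOrder.Language.{u, v}} {N : Type w} [L.Structure N] {m n : ℕ}

/-- The elementary substructure on a set of elements closed under Skolem functions. -/
theorem IsSkolemArray.exists_elementarySubstructure {φ : L.Formula (Fin m ⊕ Fin n)} {Y : Type*}
    {w : Y → N} {c : ℕ → Bool → Fin n → Y} (h : IsSkolemArray φ w c) :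
    ∃ M : L.ElementarySubstructure N, (M : Set N) = Set.range w := by
  let S : L.Substructure N :=
    { carrier := Set.range w
      fun_mem := by
        intro k f x hx
        choose t ht using hx
        obtain rfl : w ∘ t = x := funext ht
        -- Closure under `f` is the Skolem property of the formula `f(x) = y`.
        obtain ⟨t', ht'⟩ := h.skolem k ((Term.func f fun i => Term.var (Sum.inr i.castSucc)).bdEqual
          (Term.var (Sum.inr (Fin.last k)))) t
        have := ht' (Structure.funMap f (w ∘ t)) (by
          simp only [BoundedFormula.realize_bdEqual, Term.realize_func, Term.realize_var,
            Sum.elim_inr, Fin.snoc_castSucc, Fin.snoc_last])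
        simp only [BoundedFormula.realize_bdEqual, Term.realize_func, Term.realize_var,
            Sum.elim_inr, Fin.snoc_castSucc, Fin.snoc_last] at this
        exact ⟨t', this.symm⟩ }
  refine ⟨S.toElementarySubstructure fun k ψ x a ha => ?_, rfl⟩
  choose t ht using fun i => (x i).2
  have hx : ((↑) ∘ x : Fin k → N) = w ∘ t := funext fun i => (ht i).symm
  obtain ⟨t', ht'⟩ := h.skolem k ψ t
  rw [hx] at ha ⊢
  exact ⟨⟨w t', t', rfl⟩, ht' a ha⟩

/-- What holds at almost all tuples of `A`, with parameters from `A b_{<i}`, holds at `b i`; only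
finitely many parameters matter. -/
theorem IsMorleySequence.realize_of_eventually {A : Set N} {D : Ultrafilter (tuples n A)}
    {b : ℕ → Fin n → N} (hb : IsMorleySequence (average (L := L) D Set.univ) A b) {ι : Type*}
    (θ : L.Formula (Fin n ⊕ ι)) (x : ι → N) (i : ℕ) (hx : ∀ j, x j ∈ below A b i)
    (hθ : ∀ᶠ c : tuples n A in (D : Filter _), θ.Realize (Sum.elim (c : Fin n → N) x)) :
    θ.Realize (Sum.elim (b i) x) := by
  rw [← realize_restrictRight, ← realize_inst]
  refine hb i _ ⟨⟨⟨_, _, _, fun _ => Set.mem_univ _, rfl⟩, hθ.mono fun c hc => ?_⟩,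
    _, _, _, fun j => hx _, rfl⟩
  rwa [realize_inst, realize_restrictRight]

/-- A Skolem array gives two ultrafilters with the same average over a model, only one of which
makes `φ` a higher formula. -/
theorem IsSkolemArray.exists_ultrafilters {κ : Cardinal.{w}} (hκ : Cardinal.aleph0 < κ)
    (hN : IsSaturated L κ N) [Nonempty N] {A : Set N} (hA : Cardinal.mk A < κ)
    {φ : L.Formula (Fin m ⊕ Fin n)} {Y : Type*} {w : Y → N} {c : ℕ → Bool → Fin n → Y}
    (h : IsSkolemArray φ w c) (hAw : A = Set.range w) :
    ∃ D E : Ultrafilter (tuples n A), average (L := L) D A = average (L := L) E A ∧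
      IsHigher φ A D ∧ ¬ IsHigher φ A E := by
  let U : Ultrafilter ℕ := Filter.hyperfilter ℕ
  have hU : (U : Filter ℕ) ≤ Filter.atTop := Nat.hyperfilter_le_atTop
  have hmem : ∀ i e, w ∘ c i e ∈ tuples n A := fun i e t => hAw ▸ ⟨c i e t, rfl⟩
  let col : Bool → Ultrafilter (tuples n A) := fun e => U.map fun i => ⟨w ∘ c i e, hmem i e⟩
  have hcol : ∀ {ι : Type} (e : Bool) (θ : L.Formula (Fin n ⊕ ι)) (x : ι → N),
      (∀ᶠ b : tuples n A in (col e : Filter _), θ.Realize (Sum.elim (b : Fin n → N) x)) ↔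
        ∀ᶠ i in (U : Filter ℕ), θ.Realize (Sum.elim (w ∘ c i e) x) := fun _ _ _ => Iff.rfl
  refine ⟨col false, col true, ?_, fun b hb => ?_, fun hhigh => ?_⟩
  · ext ψ
    refine and_congr_right ?_
    rintro ⟨k, θ, a, ha, rfl⟩
    rw [hAw] at ha
    choose t ht using ha
    obtain rfl : w ∘ t = a := funext ht
    simp only [realize_inst]
    refine (hcol false θ _).trans (Iff.trans ?_ (hcol true θ _).symm)
    refine Filter.eventually_congr (((h.eventually_iff k θ t).filter_mono hU).mono fun i hi => hi)
  -- The induction needs arbitrary finite parts of the left column alongside `b_{<k}`: its tuples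
  -- can stand in for the next term `b k`.
  · have key : ∀ (k : ℕ) (F : Finset ℕ), ∃ x, (∀ i < k, φ.Realize (Sum.elim x (b i))) ∧
        ∀ j ∈ F, φ.Realize (Sum.elim x (w ∘ c j false)) := by
      intro k
      induction k with
      | zero =>
        intro F
        obtain ⟨x, hx⟩ := h.consistent F
        exact ⟨x, fun i hi => absurd hi (Nat.not_lt_zero i), hx⟩
      | succ k ih =>
        intro F
        let ι := (Fin k ⊕ F) × Fin n
        let y : ι → N := fun p => Sum.elim (fun i : Fin k => b i p.2)
          (fun j : F => w (c j false p.2)) p.1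
        let s : Option (Fin k ⊕ F) → Fin n → Fin n ⊕ ι := fun z t =>
          z.elim (Sum.inl t) fun z => Sum.inr (z, t)
        have hχ : ∀ d : Fin n → N, (exConj φ Finset.univ s).Realize (Sum.elim d y) ↔
            ∃ x, φ.Realize (Sum.elim x d) ∧ (∀ i < k, φ.Realize (Sum.elim x (b i))) ∧
              ∀ j ∈ F, φ.Realize (Sum.elim x (w ∘ c j false)) := by
          intro d
          rw [realize_exConj]
          refine exists_congr fun x => ⟨fun H => ⟨H none (Finset.mem_univ _), fun i hi =>
            H (some (Sum.inl ⟨i, hi⟩)) (Finset.mem_univ _), fun j hj =>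
            H (some (Sum.inr ⟨j, hj⟩)) (Finset.mem_univ _)⟩, ?_⟩
          rintro ⟨H1, H2, H3⟩ (_ | i | j) -
          exacts [H1, H2 i i.2, H3 j j.2]
        have := hb.realize_of_eventually (exConj φ Finset.univ s) y k (by
          rintro ⟨i | j, t⟩
          · exact Or.inr ⟨i, i.2, t, rfl⟩
          · exact Or.inl (hmem j false t)) ((hcol false _ _).2 (Filter.Eventually.of_forall fun i => by
            rw [hχ]
            obtain ⟨x, hx1, hx2⟩ := ih (insert i F)
            exact ⟨x, hx2 i (Finset.mem_insert_self _ _), hx1, fun j hj =>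
              hx2 j (Finset.mem_insert_of_mem hj)⟩))
        obtain ⟨x, hx1, hx2, hx3⟩ := (hχ _).1 this
        refine ⟨x, fun i hi => ?_, hx3⟩
        rcases Nat.lt_succ_iff_lt_or_eq.1 hi with hi | rfl
        exacts [hx2 i hi, hx1]
    intro F
    obtain ⟨x, hx, -⟩ := key (F.sup id + 1) ∅
    exact ⟨x, fun i hi => hx i (Nat.lt_succ_of_le (Finset.le_sup (f := id) hi))⟩
  · obtain ⟨q, hq⟩ := exists_globalType_average (L := L) (col true)
    obtain ⟨b, hb⟩ := exists_isMorleySequence hκ hN q hA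
    have hb' : IsMorleySequence (average (L := L) (col true) Set.univ) A b := fun i => by
      rw [average_inter_eq hq]
      exact hb i
    let s : Bool → Fin n → Fin n ⊕ Fin n := fun e t => bif e then Sum.inl t else Sum.inr t
    have hχ : ∀ d d' : Fin n → N, (exConj φ Finset.univ s).Realize (Sum.elim d d') ↔
        ∃ x, φ.Realize (Sum.elim x d) ∧ φ.Realize (Sum.elim x d') := by
      intro d d'
      rw [realize_exConj]
      refine exists_congr fun x => ⟨fun H => ⟨H true (Finset.mem_univ _),
        H false (Finset.mem_univ _)⟩, ?_⟩
      rintro ⟨H1, H2⟩ (_ | _) -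
      exacts [H2, H1]
    -- Almost all rows lie beyond `j`, so `b 0` conflicts with each right entry; hence `b 1`, chosen
    -- over `b 0`, conflicts with `b 0`.
    have h0 : ∀ j, ¬ ∃ x, φ.Realize (Sum.elim x (b 0)) ∧ φ.Realize (Sum.elim x (w ∘ c j true)) := by
      intro j
      rw [← hχ, ← Formula.realize_not]
      refine hb'.realize_of_eventually _ _ 0 (fun t => Or.inl (hmem j true t)) ((hcol true _ _).2 ?_)
      filter_upwards [hU (Filter.eventually_gt_atTop j)] with i hi
      rw [Formula.realize_not, hχ]
      rintro ⟨x, hx1, hx2⟩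
      exact h.inconsistent j i hi ((consistent_pair_iff _ _ _).2 ⟨x, hx2, hx1⟩)
    have h1 : ¬ ∃ x, φ.Realize (Sum.elim x (b 1)) ∧ φ.Realize (Sum.elim x (b 0)) := by
      rw [← hχ, ← Formula.realize_not]
      refine hb'.realize_of_eventually _ _ 1 (fun t => Or.inr ⟨0, Nat.one_pos, t, rfl⟩)
        ((hcol true _ _).2 (Filter.Eventually.of_forall fun j => ?_))
      rw [Formula.realize_not, hχ]
      rintro ⟨x, hx1, hx2⟩
      exact h0 j ⟨x, hx2, hx1⟩
    obtain ⟨x, hx⟩ := hhigh b hb' {0, 1}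
    exact h1 ⟨x, hx 1 (by simp), hx 0 (by simp)⟩

/-- If the theory has SOP₁, then ultrafilter independence of higher formulas fails. -/
theorem SOP1.exists_ultrafilters {T : L.Theory} (hT : T.IsComplete) {κ : Cardinal.{w}}
    (hκ : Cardinal.aleph0 < κ) (hL : Cardinal.lift.{w} L.card < Cardinal.lift.{max u v} κ)
    [Nonempty N] [N ⊨ T] (hN : IsSaturated L κ N) (h : SOP1 T) :
    ∃ M : L.ElementarySubstructure N, Cardinal.mk M < κ ∧
      ∃ (m n : ℕ) (φ : L.Formula (Fin m ⊕ Fin n)) (D E : Ultrafilter (tuples n (M : Set N))),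
        average (L := L) D (M : Set N) = average (L := L) E (M : Set N) ∧
          IsHigher φ (M : Set N) D ∧ ¬ IsHigher φ (M : Set N) E := by
  obtain ⟨N₀, m, n, φ, hφ⟩ := h
  obtain ⟨P, _, _, _, e, he⟩ := exists_isSkolemArray (T := T) hφ
  -- Completeness of `T` starts the embedding of the hull: the empty tuples have the same type.
  have h0 : SameType L (Empty.elim : Empty → P) (Empty.elim : Empty → N) := fun σ => by
    have := (hT.realize_sentence_iff σ P).trans (hT.realize_sentence_iff σ N).symm
    rwa [Subsingleton.elim (Empty.elim : Empty → P) default,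
      Subsingleton.elim (Empty.elim : Empty → N) default]
  have hcard := mk_term_lt hκ hL (V := ℕ × Bool × Fin n)
  obtain ⟨w, hw⟩ := hN.exists_family hκ h0 (by
    rw [Set.range_eq_empty, Cardinal.mk_eq_zero]
    exact Cardinal.aleph0_pos.trans hκ) e hcard
  have ha := he.transfer (hw.comp Sum.inr)
  obtain ⟨M, hM⟩ := ha.exists_elementarySubstructure
  have hMκ : Cardinal.mk M < κ := by
    change Cardinal.mk ↥(M : Set N) < κ
    rw [hM, ← Cardinal.lift_lt.{w, max u v}]
    exact Cardinal.mk_range_le_lift.trans_lt hcard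
  obtain ⟨D, E, h1, h2, h3⟩ := ha.exists_ultrafilters hκ hN hMκ hM
  exact ⟨M, hMκ, m, n, φ, D, E, h1, h2, h3⟩

end UltrafilterIndependence

end KimDividing

theorem theorem3p16 {L : FirstOrder.Language.{u, v}} (T : L.Theory) (hT : T.IsComplete)
    -- the monster model: `κ`-saturated; "small" means of cardinality less than `κ`
    (κ : Cardinal.{w}) (hκ : Cardinal.aleph0 < κ)
    (hL : Cardinal.lift.{w} L.card < Cardinal.lift.{max u v} κ)
    (𝕄 : Type w) [L.Structure 𝕄] [Nonempty 𝕄] [T.Model 𝕄]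
    (h𝕄 : KimDividing.IsSaturated L κ 𝕄) :
    [ KimDividing.NSOP1 T,
      ∀ M : L.ElementarySubstructure 𝕄, Cardinal.mk M < κ →
        ∀ (m n : ℕ) (φ : L.Formula (Fin m ⊕ Fin n))
          (D E : Ultrafilter (KimDividing.tuples n (M : Set 𝕄))),
          KimDividing.average (L := L) D (M : Set 𝕄) =
            KimDividing.average (L := L) E (M : Set 𝕄) →
          (KimDividing.IsHigher φ (M : Set 𝕄) D ↔ KimDividing.IsHigher φ (M : Set 𝕄) E),
      ∀ M : L.ElementarySubstructure 𝕄, Cardinal.mk M < κ →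
        ∀ (m n : ℕ) (φ : L.Formula (Fin m ⊕ Fin n)) (b : Fin n → 𝕄),
          (∃ q : KimDividing.GlobalType L 𝕄 n, q.IsInvariant (M : Set 𝕄) ∧
            KimDividing.tp L b (M : Set 𝕄) ⊆ q.formulas ∧
            KimDividing.QDivides φ q (M : Set 𝕄)) →
          ∀ q : KimDividing.GlobalType L 𝕄 n, q.IsInvariant (M : Set 𝕄) →
            KimDividing.tp L b (M : Set 𝕄) ⊆ q.formulas →
            KimDividing.QDivides φ q (M : Set 𝕄) ].TFAE := by
  tfae_have 1 → 3 := by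
    rintro h1 M hM m n φ b ⟨q, hq, hbq, hφq⟩ r hr hbr
    by_contra hφr
    exact h1 (KimDividing.sop1_of_qDivides hκ h𝕄 hM hq hr hbq hbr hφq hφr)
  tfae_have 3 → 2 := fun h3 M hM m n φ D E hDE =>
    KimDividing.isHigher_iff_of_kim_lemma h𝕄 hM (h3 M hM m n φ) hDE
  tfae_have 2 → 1 := by
    intro h2 hsop
    obtain ⟨M, hM, m, n, φ, D, E, hDE, hD, hE⟩ :=
      KimDividing.SOP1.exists_ultrafilters hT hκ hL h𝕄 hsop
    exact hE ((h2 M hM m n φ D E hDE).1 hD)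
  tfae_finish
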